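/- For a nonempty finite set $P\subset\mathbb{R}^d$ and a unit vector $u$, let $P[u]$ be a point of $P$ maximizing $\langle p,u\rangle$ over $p\in P$, and let $\omega(P,u)=\langle P[u]-P[-u],u\rangle$ be the width of $P$ in direction $u$. For $\varepsilon>0$, a nonempty subset $K\subseteq P$ is an $\varepsilon$-kernel of $P$ if $$\langle P[u]-K[u],u\rangle\le\varepsilon\,\omega(P,u)\qquad\text{for all unit vectors }u ,$$ and $\kappa(P,\varepsilon)$ denotes the minimum size of an $\varepsilon$-kernel of $P$. **Theorem (approximation stability in $\mathbb{R}^3$).** There is an absolute constant $C>0$ such that for every nonempty finite point set $P\subset\mathbb{R}^3$ and every $\varepsilon>0$, $$\frac{\kappa(P,\varepsilon/2)}{\kappa(P,\varepsilon)}\le C\cdot\max\{1,\log(1/\varepsilon)\}.$$ In particular, $\kappa(P,\varepsilon/2)/\kappa(P,\varepsilon)=O(\log(1/\varepsilon))$ uniformly in $P$ as $\varepsilon\to 0$. -/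

import Mathlib

noncomputable section

namespace EpsKernel

/-- `supp P u = ⟨P[u], u⟩ = max_{p ∈ P} ⟨p, u⟩`, the largest inner product with `u` over
the finite point set `P` (meant for nonempty `P`). -/
def supp {d : ℕ} (P : Finset (EuclideanSpace ℝ (Fin d))) (u : EuclideanSpace ℝ (Fin d)) : ℝ :=
  ⨆ p : P, inner ℝ (p : EuclideanSpace ℝ (Fin d)) u

/-- The directional width `ω(P, u) = ⟨P[u] - P[-u], u⟩ = ⟨P[u], u⟩ + ⟨P[-u], -u⟩`. -/
def width {d : ℕ} (P : Finset (EuclideanSpace ℝ (Fin d))) (u : EuclideanSpace ℝ (Fin d)) : ℝ :=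
  supp P u + supp P (-u)

/-- `K` is an `ε`-kernel of `P`: `K ⊆ P` and `⟨P[u] - K[u], u⟩ ≤ ε ω(P, u)` for all unit
vectors `u`. Nonemptiness of `K` is what makes `K[u]` meaningful. -/
structure IsKernel {d : ℕ} (ε : ℝ) (P K : Finset (EuclideanSpace ℝ (Fin d))) : Prop where
  subset : K ⊆ P
  nonempty : K.Nonempty
  le_width : ∀ u : EuclideanSpace ℝ (Fin d), ‖u‖ = 1 → supp P u - supp K u ≤ ε * width P u

/-- `κ(P, ε)`: the minimum size of an `ε`-kernel of `P`. -/
def kappa {d : ℕ} (P : Finset (EuclideanSpace ℝ (Fin d))) (ε : ℝ) : ℕ :=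
  sInf {n : ℕ | ∃ K : Finset (EuclideanSpace ℝ (Fin d)), IsKernel ε P K ∧ K.card = n}

theorem le_supp {d : ℕ} {P : Finset (EuclideanSpace ℝ (Fin d))} {p : EuclideanSpace ℝ (Fin d)}
    (hp : p ∈ P) (u : EuclideanSpace ℝ (Fin d)) : inner ℝ p u ≤ supp P u :=
  le_ciSup (f := fun q : P => inner ℝ (q : EuclideanSpace ℝ (Fin d)) u)
    (Set.finite_range _).bddAbove ⟨p, hp⟩

theorem width_nonneg {d : ℕ} {P : Finset (EuclideanSpace ℝ (Fin d))} (hP : P.Nonempty)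
    (u : EuclideanSpace ℝ (Fin d)) : 0 ≤ width P u := by
  obtain ⟨p, hp⟩ := hP
  have h1 := le_supp hp u
  have h2 := le_supp hp (-u)
  rw [inner_neg_right] at h2
  unfold width
  linarith

/-- A nonempty finite set is a kernel of itself, so the minimum in `kappa` is over a nonempty set. -/
theorem isKernel_self {d : ℕ} {P : Finset (EuclideanSpace ℝ (Fin d))} (hP : P.Nonempty)
    {ε : ℝ} (hε : 0 < ε) : IsKernel ε P P :=
  ⟨Finset.Subset.refl P, hP, fun u _ => by
    rw [sub_self]; exact mul_nonneg hε.le (width_nonneg hP u)⟩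

/-- The minimum in `kappa` is attained. -/
theorem exists_isKernel_card_eq_kappa {d : ℕ} {P : Finset (EuclideanSpace ℝ (Fin d))}
    (hP : P.Nonempty) {ε : ℝ} (hε : 0 < ε) :
    ∃ K : Finset (EuclideanSpace ℝ (Fin d)), IsKernel ε P K ∧ K.card = kappa P ε :=
  Nat.sInf_mem (s := {n : ℕ | ∃ K : Finset (EuclideanSpace ℝ (Fin d)),
    IsKernel ε P K ∧ K.card = n}) ⟨P.card, P, isKernel_self hP hε, rfl⟩

/-- `κ(P, ε) ≥ 1`, so the ratio of two values of `kappa` is a genuine quotient. -/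
theorem kappa_pos {d : ℕ} {P : Finset (EuclideanSpace ℝ (Fin d))} (hP : P.Nonempty)
    {ε : ℝ} (hε : 0 < ε) : 0 < kappa P ε := by
  obtain ⟨K, hK, hc⟩ := exists_isKernel_card_eq_kappa hP hε
  rw [← hc]
  exact Finset.card_pos.mpr hK.nonempty

end EpsKernel

end

namespace EpsKernel

open Finset

/-! From a minimum `ε`-kernel `K` one builds an `ε/2`-kernel with `O(|K| log(1/ε))` points.
Coordinates with respect to a determinant-maximizing basis of differences of points
(`exists_coords`) place `P` in a cube and make the width in a direction comparable to the sup norm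
of its coordinate vector, so relative error becomes absolute error. On each of the six faces of the
cube of directions the points become affine functions on a square, and a kernel is a subfamily
approximating their upper envelope.

The envelope of `K` cuts the square into at most `5|K|` trapezoids, each with a single maximal `k ∈
K` (`exists_trapezoids`); the linear count is a charging argument (`exists_triples`). On one
trapezoid every `p ∈ P` exceeds `k` by at most a multiple of `ε`. Dividing the differences by that
multiple gives functions with values in `[-N, 1]`, `N = O(1/ε)`, with `k` becoming `0`; they are
bi-affine in coordinates `(r, s)` adapted to the trapezoid.

It remains to approximate the maximum of such functions to a small constant by `O(log N)` of them
(`exists_subset_biaffine`). On a line of constant `r` boundedly many suffice: for each of finitely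
many levels, keep the function reaching it first. Across lines, an affine function of `r` bounded
above by `1` that is not very negative at a point varies little over a small fraction of the
distance to the ends. So a geometric grid towards `r = 0` and `r = 1` is enough, and the lower bound
`-N`, which caps the slopes, lets it stop after `O(log N)` lines. -/

/-! ### Maxima of affine functions of one variable -/

/-- Among finitely many monotone functions one reaches the level `t` first. -/
theorem exists_level_dominator {ι : Type*} (t : ℝ) (ψ : ι → ℝ → ℝ) {P : Finset ι}
    (hP : P.Nonempty) (hmono : ∀ p ∈ P, Monotone (ψ p)) :
    ∃ p ∈ P, ∀ q ∈ P, ∀ s, t ≤ ψ q s → t ≤ ψ p s := by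
  classical
  induction hP using Finset.Nonempty.cons_induction with
  | singleton a => exact ⟨a, by simp, by simp⟩
  | cons a P ha hP ih =>
    obtain ⟨p, hp, hdom⟩ := ih fun q hq => hmono q (by simp [hq])
    by_cases h : ∀ s, t ≤ ψ a s → t ≤ ψ p s
    · refine ⟨p, by simp [hp], fun q hq s hs => ?_⟩
      rcases Finset.mem_cons.1 hq with rfl | hq
      · exact h s hs
      · exact hdom q hq s hs
    · push Not at h
      obtain ⟨s₀, h1, h2⟩ := h
      -- Superlevel sets of monotone functions are nested up-sets: `s₀` lies in that of `a` but not
      -- in that of `p`, so the latter is the smaller one.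
      have key : ∀ s, t ≤ ψ p s → t ≤ ψ a s := fun s hs => by
        have : s₀ ≤ s := by
          by_contra! hlt
          exact absurd (hmono p (by simp [hp]) hlt.le) (by linarith)
        exact h1.trans (hmono a (by simp) this)
      refine ⟨a, by simp, fun q hq s hs => ?_⟩
      rcases Finset.mem_cons.1 hq with rfl | hq
      · exact hs
      · exact key s (hdom q hq s hs)

/-- The maximum of finitely many monotone functions is approximated, where it lies in `[0, 1]`,
to accuracy `1 / m` by `m + 1` of them. -/
theorem exists_subset_monotone {ι : Type*} (m : ℕ) (hm : 0 < m) (ψ : ι → ℝ → ℝ) (P : Finset ι)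
    (hmono : ∀ p ∈ P, Monotone (ψ p)) :
    ∃ P' ⊆ P, P'.card ≤ m + 1 ∧ ∀ p ∈ P, ∀ s, 0 ≤ ψ p s → ψ p s ≤ 1 →
      ∃ q ∈ P', ψ p s ≤ ψ q s + 1 / m := by
  classical
  rcases P.eq_empty_or_nonempty with rfl | hP
  · exact ⟨∅, by simp, by simp, by simp⟩
  -- One function for each level `j / m`; rounding a value down to the nearest level loses at most
  -- `1 / m`.
  choose g hg hdom using fun j : ℕ => exists_level_dominator ((j : ℝ) / m) ψ hP hmono
  refine ⟨(range (m + 1)).image g, ?_, ?_, ?_⟩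
  · intro q hq
    obtain ⟨j, -, rfl⟩ := Finset.mem_image.1 hq
    exact hg j
  · exact Finset.card_image_le.trans (by simp)
  · intro p hp s h0 h1
    have hm' : (0 : ℝ) < m := by exact_mod_cast hm
    have hfl : (⌊ψ p s * m⌋₊ : ℝ) ≤ ψ p s * m := Nat.floor_le (by positivity)
    have hlt := Nat.lt_floor_add_one (ψ p s * m)
    refine ⟨g ⌊ψ p s * m⌋₊, Finset.mem_image_of_mem _ ?_, ?_⟩
    · rw [Finset.mem_range, Nat.lt_succ_iff]
      have : (⌊ψ p s * m⌋₊ : ℝ) ≤ m := hfl.trans (by nlinarith)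
      exact_mod_cast this
    · have := hdom ⌊ψ p s * m⌋₊ p hp s (by rw [div_le_iff₀ hm']; exact hfl)
      rw [div_le_iff₀ hm'] at this
      refine le_of_mul_le_mul_right ?_ hm'
      rw [add_mul, one_div, inv_mul_cancel₀ hm'.ne']
      linarith

/-- The maximum of finitely many affine functions of one variable is approximated, where it lies
in `[0, 1]`, to accuracy `1 / m` by `2 (m + 1)` of them. -/
theorem exists_subset_affine {ι : Type*} (m : ℕ) (hm : 0 < m) (u v : ι → ℝ) (P : Finset ι) :
    ∃ P' ⊆ P, P'.card ≤ 2 * (m + 1) ∧ ∀ p ∈ P, ∀ s, 0 ≤ u p + v p * s → u p + v p * s ≤ 1 →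
      ∃ q ∈ P', u p + v p * s ≤ u q + v q * s + 1 / m := by
  classical
  obtain ⟨P₁, h₁, hc₁, ha₁⟩ := exists_subset_monotone m hm (fun p s => u p + v p * s)
    (P.filter fun p => 0 ≤ v p) (by
      intro p hp s t hst
      have := (Finset.mem_filter.1 hp).2
      dsimp only
      nlinarith)
  -- Negative slopes become monotone under `s ↦ -s`.
  obtain ⟨P₂, h₂, hc₂, ha₂⟩ := exists_subset_monotone m hm (fun p s => u p + v p * (-s))
    (P.filter fun p => ¬ 0 ≤ v p) (by
      intro p hp s t hst
      have := (Finset.mem_filter.1 hp).2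
      dsimp only
      nlinarith)
  refine ⟨P₁ ∪ P₂, Finset.union_subset (h₁.trans (Finset.filter_subset _ _))
    (h₂.trans (Finset.filter_subset _ _)), (Finset.card_union_le _ _).trans (by omega), ?_⟩
  intro p hp s h0 h1
  by_cases hv : 0 ≤ v p
  · obtain ⟨q, hq, h⟩ := ha₁ p (by simp [hp, hv]) s h0 h1
    exact ⟨q, Finset.mem_union_left _ hq, h⟩
  · obtain ⟨q, hq, h⟩ := ha₂ p (by simp only [Finset.mem_filter]; exact ⟨hp, hv⟩) (-s)
      (by simpa using h0) (by simpa using h1)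
    exact ⟨q, Finset.mem_union_right _ hq, by simpa using h⟩

/-! ### Bi-affine functions and the geometric grid -/

/-- An affine function bounded by `1` changes little from `r` to a nearby smaller parameter `r₀`,
as long as it is nonnegative at `r` and bounded at `3 r / 2`. -/
theorem affine_le_of_le_one_right {b c r r₀ : ℝ} (hr : 0 < r) (h1 : 999 / 1000 * r ≤ r₀)
    (h2 : r₀ ≤ r) (hnn : 0 ≤ b + c * r) (hout : b + c * (3 / 2 * r) ≤ 1) :
    b + c * r ≤ b + c * r₀ + 1 / 500 := by
  have hc : c * r ≤ 2 := by linarith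
  rcases le_total c 0 with h | h
  · nlinarith
  · nlinarith

/-- The upper bound at `r / 2` limits the rate of decrease, so a function chosen on the grid line
`r₀` is still large at `r`. The chosen function need not be nonnegative at `r₀`, hence the weaker
bound `-1`. -/
theorem affine_le_of_le_one_left {b c r r₀ : ℝ} (hr : 0 < r) (h1 : 999 / 1000 * r ≤ r₀)
    (h2 : r₀ ≤ r) (hnn : -1 ≤ b + c * r₀) (hfar : b + c * (r / 2) ≤ 1) :
    b + c * r₀ ≤ b + c * r + 1 / 100 := by
  rcases le_total c 0 with h | h
  · have h3 : c * (r₀ - r / 2) ≥ -2 := by linarith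
    have h4 : c * r ≥ -5 := by nlinarith
    nlinarith
  · nlinarith

/-- There is a power of `ρ = 999 / 1000` just below a number between `ρ ^ A` and `1`. -/
theorem exists_pow_near {A : ℕ} {t : ℝ} (ht : t ≤ 1) (hA : (999 / 1000 : ℝ) ^ A ≤ t) :
    ∃ j ≤ A, (999 / 1000 : ℝ) ^ j ≤ t ∧ 999 / 1000 * t ≤ (999 / 1000 : ℝ) ^ j := by
  classical
  have hex : ∃ j, (999 / 1000 : ℝ) ^ j ≤ t := ⟨A, hA⟩
  refine ⟨Nat.find hex, Nat.find_le hA, Nat.find_spec hex, ?_⟩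
  rcases Nat.eq_zero_or_pos (Nat.find hex) with h | h
  · rw [h, pow_zero]; linarith
  · obtain ⟨i, hi⟩ := Nat.exists_eq_succ_of_ne_zero h.ne'
    have := Nat.find_min hex (m := i) (by omega)
    rw [hi, pow_succ]
    push Not at this
    linarith

/-- Approximation of the maximum of finitely many bi-affine functions near the side `r = 0`. -/
theorem exists_subset_biaffine_half {ι : Type*} (P : Finset ι) (c₀ c₁ c₂ c₃ : ι → ℝ) (N : ℝ)
    (A : ℕ) (hA : (N + 1) * (999 / 1000 : ℝ) ^ A ≤ 1 / 100) {k : ι} (hk : k ∈ P)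
    (hφk : ∀ r s, c₀ k + c₁ k * r + c₂ k * s + c₃ k * r * s = 0)
    (hφ : ∀ p ∈ P, ∀ r ∈ Set.Ioo (0 : ℝ) 1, ∀ s ∈ Set.Icc (0 : ℝ) 1,
      c₀ p + c₁ p * r + c₂ p * s + c₃ p * r * s ∈ Set.Icc (-N) 1) :
    ∃ P' ⊆ P, P'.card ≤ (A + 1) * 202 ∧
      ∀ r ∈ Set.Ioc (0 : ℝ) (1 / 2), ∀ s ∈ Set.Icc (0 : ℝ) 1, ∀ p ∈ P, ∃ q ∈ P',
        c₀ p + c₁ p * r + c₂ p * s + c₃ p * r * s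
          ≤ c₀ q + c₁ q * r + c₂ q * s + c₃ q * r * s + 1 / 24 := by
  classical
  -- Grid lines `r = ρ ^ j / 2` with `ρ = 999 / 1000`, each contributing `2 * (100 + 1) = 202`
  -- functions of `s`.
  choose g hg hgc hga using fun j : ℕ => exists_subset_affine 100 (by norm_num)
    (fun p => c₀ p + c₁ p * ((999 / 1000 : ℝ) ^ j / 2))
    (fun p => c₂ p + c₃ p * ((999 / 1000 : ℝ) ^ j / 2)) P
  refine ⟨(range (A + 1)).biUnion g, Finset.biUnion_subset.2 fun j _ => hg j, ?_, ?_⟩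
  · calc _ ≤ ∑ j ∈ range (A + 1), (g j).card := Finset.card_biUnion_le
      _ ≤ ∑ j ∈ range (A + 1), 202 := Finset.sum_le_sum fun j _ => hgc j
      _ = _ := by simp
  -- rewriting for a fixed `s`
  have hre : ∀ p r s, c₀ p + c₁ p * r + c₂ p * s + c₃ p * r * s
      = (c₀ p + c₂ p * s) + (c₁ p + c₃ p * s) * r := fun p r s => by ring
  have hre' : ∀ p r s, c₀ p + c₁ p * r + c₂ p * s + c₃ p * r * s
      = c₀ p + c₁ p * r + (c₂ p + c₃ p * r) * s := fun p r s => by ring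
  -- the grid lines
  have hline : ∀ j ≤ A, ∀ s ∈ Set.Icc (0 : ℝ) 1, ∀ p ∈ P,
      0 ≤ c₀ p + c₁ p * ((999 / 1000 : ℝ) ^ j / 2) + c₂ p * s
        + c₃ p * ((999 / 1000 : ℝ) ^ j / 2) * s → ∃ q ∈ (range (A + 1)).biUnion g, q ∈ P ∧
      c₀ p + c₁ p * ((999 / 1000 : ℝ) ^ j / 2) + c₂ p * s
        + c₃ p * ((999 / 1000 : ℝ) ^ j / 2) * s ≤
      c₀ q + c₁ q * ((999 / 1000 : ℝ) ^ j / 2) + c₂ q * s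
        + c₃ q * ((999 / 1000 : ℝ) ^ j / 2) * s + 1 / 100 := by
    intro j hj s hs p hp h0
    have hmem : (999 / 1000 : ℝ) ^ j / 2 ∈ Set.Ioo (0 : ℝ) 1 := by
      have : (999 / 1000 : ℝ) ^ j ≤ 1 := pow_le_one₀ (by norm_num) (by norm_num)
      exact ⟨by positivity, by linarith⟩
    have hle := (hφ p hp _ hmem s hs).2
    rw [hre'] at h0 hle
    obtain ⟨q, hq, h⟩ := hga j p hp s h0 hle
    refine ⟨q, Finset.mem_biUnion.2 ⟨j, by simp; omega, hq⟩, hg j hq, ?_⟩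
    rw [hre', hre' q]
    simpa using h
  -- nonnegative values suffice
  suffices H : ∀ r ∈ Set.Ioc (0 : ℝ) (1 / 2), ∀ s ∈ Set.Icc (0 : ℝ) 1, ∀ p ∈ P,
      0 ≤ c₀ p + c₁ p * r + c₂ p * s + c₃ p * r * s → ∃ q ∈ (range (A + 1)).biUnion g,
        c₀ p + c₁ p * r + c₂ p * s + c₃ p * r * s
          ≤ c₀ q + c₁ q * r + c₂ q * s + c₃ q * r * s + 1 / 24 by
    intro r hr s hs p hp
    rcases le_total 0 (c₀ p + c₁ p * r + c₂ p * s + c₃ p * r * s) with h | h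
    · exact H r hr s hs p hp h
    · obtain ⟨q, hq, h'⟩ := H r hr s hs k hk (hφk r s).ge
      exact ⟨q, hq, by linarith [hφk r s]⟩
  -- an element with nonnegative value at each point, with large value on the next line
  have hbest : ∀ j ≤ A, ∀ s ∈ Set.Icc (0 : ℝ) 1, ∀ p ∈ P, ∃ q ∈ (range (A + 1)).biUnion g, q ∈ P ∧
      (c₀ p + c₂ p * s) + (c₁ p + c₃ p * s) * ((999 / 1000 : ℝ) ^ j / 2) ≤
        (c₀ q + c₂ q * s) + (c₁ q + c₃ q * s) * ((999 / 1000 : ℝ) ^ j / 2) + 1 / 100 ∧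
      -1 ≤ (c₀ q + c₂ q * s) + (c₁ q + c₃ q * s) * ((999 / 1000 : ℝ) ^ j / 2) := by
    intro j hj s hs p hp
    rcases le_total 0 (c₀ p + c₁ p * ((999 / 1000 : ℝ) ^ j / 2) + c₂ p * s
        + c₃ p * ((999 / 1000 : ℝ) ^ j / 2) * s) with h | h
    · obtain ⟨q, hq, hqP, h'⟩ := hline j hj s hs p hp h
      refine ⟨q, hq, hqP, ?_⟩
      rw [← hre, ← hre]
      exact ⟨h', by linarith⟩
    -- If `p` is negative on the line, the zero function of `k` takes its place.
    · obtain ⟨q, hq, hqP, h'⟩ := hline j hj s hs k hk (hφk _ _).ge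
      refine ⟨q, hq, hqP, ?_⟩
      rw [hφk] at h'
      rw [← hre, ← hre]
      exact ⟨by linarith, by linarith⟩
  intro r hr s hs p hp h0
  obtain ⟨hr0, hr1⟩ := hr
  simp only [hre] at hφ h0 ⊢
  -- Beyond the last grid line, compare with the line just below `r`: the errors are `1/500` for
  -- `p`, `1/100` on the line and `1/100` for `q`, together below `1/24`.
  rcases le_total ((999 / 1000 : ℝ) ^ A / 2) r with hAr | hAr
  · obtain ⟨j, hj, h1, h2⟩ := exists_pow_near (t := 2 * r) (A := A) (by linarith) (by linarith)
    obtain ⟨q, hq, hqP, h3, h4⟩ := hbest j hj s hs p hp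
    refine ⟨q, hq, ?_⟩
    have e1 := affine_le_of_le_one_right (r := r) (r₀ := (999 / 1000 : ℝ) ^ j / 2) hr0
      (by linarith) (by linarith) h0 (hφ p hp (3 / 2 * r) ⟨by linarith, by linarith⟩ s hs).2
    have e2 := affine_le_of_le_one_left (r := r) (r₀ := (999 / 1000 : ℝ) ^ j / 2) hr0
      (by linarith) (by linarith) h4 (hφ q hqP (r / 2) ⟨by linarith, by linarith⟩ s hs).2
    linarith
  · obtain ⟨q, hq, hqP, h3, h4⟩ := hbest A le_rfl s hs p hp
    refine ⟨q, hq, ?_⟩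
    -- Nearer the side than the last line, the slope bound from the values at `1/4` and `3/4`
    -- applies; `hA` makes the change over a length `ρ ^ A / 2` at most `1/100`.
    have hsl : ∀ p ∈ P, |c₁ p + c₃ p * s| ≤ 2 * (N + 1) := fun p hp => by
      have e1 := hφ p hp (1 / 4) ⟨by norm_num, by norm_num⟩ s hs
      have e2 := hφ p hp (3 / 4) ⟨by norm_num, by norm_num⟩ s hs
      rw [abs_le]
      constructor <;> linarith [e1.1, e1.2, e2.1, e2.2]
    have hd : ∀ p ∈ P, |(c₁ p + c₃ p * s) * ((999 / 1000 : ℝ) ^ A / 2 - r)| ≤ 1 / 100 :=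
      fun p hp => by
        rw [abs_mul, abs_of_nonneg (sub_nonneg.2 hAr)]
        have h5 := hsl p hp
        have h6 := abs_nonneg (c₁ p + c₃ p * s)
        calc _ ≤ 2 * (N + 1) * ((999 / 1000 : ℝ) ^ A / 2) := by
              apply mul_le_mul h5 (by linarith) (by linarith) (by linarith)
          _ ≤ 1 / 100 := by linarith
    have e1 := abs_le.1 (hd p hp)
    have e2 := abs_le.1 (hd q hqP)
    linarith [e1.1, e2.2]

/-- The maximum of finitely many bi-affine functions on `(0, 1) × [0, 1]` with values in `[0, 1]`
is approximated by logarithmically many of them. -/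
theorem exists_subset_biaffine {ι : Type*} (P : Finset ι) (c₀ c₁ c₂ c₃ : ι → ℝ) (N : ℝ)
    (A : ℕ) (hA : (N + 1) * (999 / 1000 : ℝ) ^ A ≤ 1 / 100) {k : ι} (hk : k ∈ P)
    (hφk : ∀ r s, c₀ k + c₁ k * r + c₂ k * s + c₃ k * r * s = 0)
    (hφ : ∀ p ∈ P, ∀ r ∈ Set.Ioo (0 : ℝ) 1, ∀ s ∈ Set.Icc (0 : ℝ) 1,
      c₀ p + c₁ p * r + c₂ p * s + c₃ p * r * s ∈ Set.Icc (-N) 1) :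
    ∃ P' ⊆ P, P'.card ≤ 404 * (A + 1) ∧
      ∀ r ∈ Set.Ioo (0 : ℝ) 1, ∀ s ∈ Set.Icc (0 : ℝ) 1, ∀ p ∈ P, ∃ q ∈ P',
        c₀ p + c₁ p * r + c₂ p * s + c₃ p * r * s
          ≤ c₀ q + c₁ q * r + c₂ q * s + c₃ q * r * s + 1 / 24 := by
  classical
  obtain ⟨P₁, h₁, hc₁, ha₁⟩ := exists_subset_biaffine_half P c₀ c₁ c₂ c₃ N A hA hk hφk hφ
  -- The reflection `r ↦ 1 - r` preserves the hypotheses and handles the other half.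
  have hflip : ∀ p r s, (c₀ p + c₁ p) + (-c₁ p) * r + (c₂ p + c₃ p) * s + (-c₃ p) * r * s
      = c₀ p + c₁ p * (1 - r) + c₂ p * s + c₃ p * (1 - r) * s := fun p r s => by ring
  obtain ⟨P₂, h₂, hc₂, ha₂⟩ := exists_subset_biaffine_half P (fun p => c₀ p + c₁ p)
    (fun p => -c₁ p) (fun p => c₂ p + c₃ p) (fun p => -c₃ p) N A hA hk
    (fun r s => by simpa only [hflip] using hφk (1 - r) s)
    (fun p hp r hr s hs => by
      simpa only [hflip] using hφ p hp (1 - r) ⟨by linarith [hr.2], by linarith [hr.1]⟩ s hs)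
  refine ⟨P₁ ∪ P₂, Finset.union_subset h₁ h₂, (Finset.card_union_le _ _).trans (by omega), ?_⟩
  intro r hr s hs p hp
  rcases le_total r (1 / 2) with h | h
  · obtain ⟨q, hq, hle⟩ := ha₁ r ⟨hr.1, h⟩ s hs p hp
    exact ⟨q, Finset.mem_union_left _ hq, hle⟩
  · obtain ⟨q, hq, hle⟩ := ha₂ (1 - r) ⟨by linarith [hr.2], by linarith⟩ s hs p hp
    simp only [hflip, sub_sub_cancel] at hle
    exact ⟨q, Finset.mem_union_right _ hq, hle⟩

/-! ### Approximation on one trapezoid -/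

/-- A trapezoid with two vertical sides at `x = a` and `x = b`, between two lines. -/
structure Trapezoid where
  a : ℝ
  b : ℝ
  lo₀ : ℝ
  lo₁ : ℝ
  hi₀ : ℝ
  hi₁ : ℝ

namespace Trapezoid

/-- The lower bounding line. -/
def lo (T : Trapezoid) (x : ℝ) : ℝ := T.lo₀ + T.lo₁ * x

/-- The upper bounding line. -/
def hi (T : Trapezoid) (x : ℝ) : ℝ := T.hi₀ + T.hi₁ * x

/-- The points of the trapezoid off its vertical sides. -/
def Mem (T : Trapezoid) (x y : ℝ) : Prop := T.a < x ∧ x < T.b ∧ T.lo x ≤ y ∧ y ≤ T.hi x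

end Trapezoid

theorem exists_mem_Icc_eq {l h y : ℝ} (h1 : l ≤ y) (h2 : y ≤ h) :
    ∃ s ∈ Set.Icc (0 : ℝ) 1, y = l + s * (h - l) := by
  rcases (h1.trans h2).eq_or_lt with e | e
  · exact ⟨0, by simp, by linarith⟩
  · have : 0 < h - l := by linarith
    refine ⟨(y - l) / (h - l), ⟨by apply div_nonneg <;> linarith, ?_⟩, ?_⟩
    · rw [div_le_one this]; linarith
    · rw [div_mul_cancel₀ _ this.ne']; ring

/-- If `a_k` is within `ε` of the maximum of finitely many affine functions on a trapezoid, then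
logarithmically many of the functions approximate the maximum to `ε / 24` there. -/
theorem exists_subset_trapezoid {ι : Type*} (P : Finset ι) (α β γ : ι → ℝ) (T : Trapezoid)
    (hT : ∀ x, T.a < x → x < T.b → T.lo x ≤ T.hi x) {k : ι} (hk : k ∈ P) {ε M : ℝ} (hε : 0 < ε)
    (A : ℕ) (hA : (M / ε + 1) * (999 / 1000 : ℝ) ^ A ≤ 1 / 100)
    (hP : ∀ x y, T.Mem x y → ∀ p ∈ P,
      (α p + β p * x + γ p * y) - (α k + β k * x + γ k * y) ∈ Set.Icc (-M) ε) :
    ∃ P' ⊆ P, P'.card ≤ 404 * (A + 1) ∧ ∀ x y, T.Mem x y → ∀ p ∈ P, ∃ q ∈ P',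
      α p + β p * x + γ p * y ≤ α q + β q * x + γ q * y + ε / 24 := by
  obtain ⟨a, b, l₀, l₁, h₀, h₁⟩ := T
  simp only [Trapezoid.Mem, Trapezoid.lo, Trapezoid.hi] at hT hP ⊢
  rcases le_or_gt b a with hab | hab
  · exact ⟨∅, by simp, by simp, fun x y hxy => by linarith [hxy.1, hxy.2.1]⟩
  -- coefficients in the coordinates `r`, `s`
  set D₀ : ι → ℝ := fun p => (α p - α k) / ε with hD₀
  set D₁ : ι → ℝ := fun p => (β p - β k) / ε with hD₁
  set D₂ : ι → ℝ := fun p => (γ p - γ k) / ε with hD₂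
  set X : ℝ → ℝ := fun r => a + (b - a) * r with hX
  set Y : ℝ → ℝ → ℝ := fun r s => (l₀ + l₁ * X r) + s * ((h₀ + h₁ * X r) - (l₀ + l₁ * X r)) with hY
  -- Since `X` is affine and `Y` bi-affine, affine functions of `(x, y)` pull back to bi-affine
  -- ones. Subtracting the function of `k` and dividing by `ε` turns `k` into `0` and the bounds
  -- into `-M / ε` and `1`.
  have key : ∀ p r s,
      (D₀ p + D₁ p * a + D₂ p * (l₀ + l₁ * a)) + (D₁ p * (b - a) + D₂ p * (l₁ * (b - a))) * r
        + (D₂ p * ((h₀ - l₀) + (h₁ - l₁) * a)) * s + (D₂ p * ((h₁ - l₁) * (b - a))) * r * s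
      = ((α p + β p * X r + γ p * Y r s) - (α k + β k * X r + γ k * Y r s)) / ε := by
    intro p r s
    simp only [hD₀, hD₁, hD₂, hX, hY]
    field_simp
    ring
  have hmem : ∀ r ∈ Set.Ioo (0 : ℝ) 1, ∀ s ∈ Set.Icc (0 : ℝ) 1, a < X r ∧ X r < b ∧
      l₀ + l₁ * X r ≤ Y r s ∧ Y r s ≤ h₀ + h₁ * X r := by
    intro r hr s hs
    have h1 : a < X r := by simp only [hX]; nlinarith [hr.1]
    have h2 : X r < b := by simp only [hX]; nlinarith [hr.2]
    have h3 := hT _ h1 h2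
    refine ⟨h1, h2, ?_, ?_⟩
    · simp only [hY]; nlinarith [hs.1]
    · simp only [hY]; nlinarith [hs.2]
  obtain ⟨P', hP', hc, happ⟩ := exists_subset_biaffine P
    (fun p => D₀ p + D₁ p * a + D₂ p * (l₀ + l₁ * a))
    (fun p => D₁ p * (b - a) + D₂ p * (l₁ * (b - a)))
    (fun p => D₂ p * ((h₀ - l₀) + (h₁ - l₁) * a))
    (fun p => D₂ p * ((h₁ - l₁) * (b - a))) (M / ε) A hA hk
    (fun r s => by rw [key]; simp)
    (fun p hp r hr s hs => by
      have := hP _ _ (hmem r hr s hs) p hp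
      rw [key]
      constructor
      · rw [← neg_div]; exact div_le_div_of_nonneg_right this.1 hε.le
      · rw [div_le_one hε]; exact this.2)
  refine ⟨P', hP', hc, ?_⟩
  rintro x y ⟨hx1, hx2, hy1, hy2⟩ p hp
  obtain ⟨s, hs, hys⟩ := exists_mem_Icc_eq hy1 hy2
  have hba : 0 < b - a := by linarith
  have hXr : X ((x - a) / (b - a)) = x := by
    simp only [hX]; rw [mul_div_cancel₀ _ hba.ne']; ring
  have hYr : Y ((x - a) / (b - a)) s = y := by simp only [hY, hXr]; exact hys.symm
  obtain ⟨q, hq, hle⟩ := happ ((x - a) / (b - a))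
    ⟨by apply div_pos <;> linarith, by rw [div_lt_one hba]; linarith⟩ s hs p hp
  refine ⟨q, hq, ?_⟩
  rw [key, key, hXr, hYr, div_le_iff₀ hε, add_mul, div_mul_cancel₀ _ hε.ne'] at hle
  linarith

/-- With `L = max 1 (log (1/ε))`, the choice `A = ⌈1000 (7 + L)⌉` works: `999/1000 ≤ exp (-1/1000)`
gives a power at most `exp (-(7 + L))`, while `8/ε + 1 ≤ 9 exp L` and `exp 7 ≥ 900`. Since `L ≥ 1`,
`A + 1 ≤ 7002 + 1000 L ≤ 8002 L`. -/
theorem exists_pow_le_log : ∃ C : ℝ, 0 < C ∧ ∀ ε : ℝ, 0 < ε → ∃ A : ℕ,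
    (8 / ε + 1) * (999 / 1000 : ℝ) ^ A ≤ 1 / 100 ∧ ((A + 1 : ℕ) : ℝ) ≤ C * max 1 (Real.log (1 / ε)) := by
  refine ⟨8002, by norm_num, fun ε hε => ?_⟩
  set L := max 1 (Real.log (1 / ε)) with hL
  have hL1 : 1 ≤ L := le_max_left _ _
  have hexp : 1 / ε ≤ Real.exp L := by
    rw [← Real.exp_log (show 0 < 1 / ε by positivity)]
    exact Real.exp_le_exp.2 (le_max_right _ _)
  have hexp1 : 1 ≤ Real.exp L := Real.one_le_exp (by linarith)
  refine ⟨⌈1000 * (7 + L)⌉₊, ?_, ?_⟩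
  · have h1 : 8 / ε + 1 ≤ 9 * Real.exp L := by
      rw [div_eq_mul_one_div]; linarith
    have h2 : (999 / 1000 : ℝ) ^ ⌈1000 * (7 + L)⌉₊ ≤ Real.exp (-(7 + L)) := by
      calc (999 / 1000 : ℝ) ^ ⌈1000 * (7 + L)⌉₊
          ≤ (Real.exp (-(1 / 1000))) ^ ⌈1000 * (7 + L)⌉₊ := by
            apply pow_le_pow_left₀ (by norm_num)
            have := Real.add_one_le_exp (-(1 / 1000 : ℝ))
            linarith
        _ = Real.exp (⌈1000 * (7 + L)⌉₊ * (-(1 / 1000))) := by rw [Real.exp_nat_mul]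
        _ ≤ _ := by
            apply Real.exp_le_exp.2
            have := Nat.le_ceil (1000 * (7 + L))
            linarith
    have h3 : (900 : ℝ) ≤ Real.exp 7 := by
      have e1 : (2.7 : ℝ) ≤ Real.exp 1 := by linarith [Real.exp_one_gt_d9]
      have e2 : Real.exp 7 = (Real.exp 1) ^ 7 := by rw [← Real.exp_nat_mul]; norm_num
      rw [e2]
      calc (900 : ℝ) ≤ 2.7 ^ 7 := by norm_num
        _ ≤ _ := pow_le_pow_left₀ (by norm_num) e1 7
    have hpos : 0 < 8 / ε + 1 := by positivity
    calc (8 / ε + 1) * (999 / 1000 : ℝ) ^ ⌈1000 * (7 + L)⌉₊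
        ≤ (9 * Real.exp L) * Real.exp (-(7 + L)) := by
          apply mul_le_mul h1 h2 (by positivity) (by positivity)
      _ = 9 / Real.exp 7 := by
          rw [neg_add, Real.exp_add, Real.exp_neg, Real.exp_neg]
          field_simp
      _ ≤ 1 / 100 := by
          rw [div_le_div_iff₀ (by positivity) (by norm_num)]
          linarith
  · have := Nat.ceil_lt_add_one (show 0 ≤ 1000 * (7 + L) by linarith)
    push_cast
    linarith

/-! ### Counting consecutive triples in a sweep -/

/-- `k < l` are consecutive elements of `S`. -/
def Consec (S : Set ℕ) (k l : ℕ) : Prop := k < l ∧ k ∈ S ∧ l ∈ S ∧ ∀ q, k < q → q < l → q ∉ S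

theorem Consec.right_unique {S : Set ℕ} {k l l' : ℕ} (h : Consec S k l) (h' : Consec S k l') :
    l = l' := by
  rcases lt_trichotomy l l' with e | e | e
  · exact absurd h.2.2.1 (h'.2.2.2 l h.1 e)
  · exact e
  · exact absurd h'.2.2.1 (h.2.2.2 l' h'.1 e)

theorem Consec.left_unique {S : Set ℕ} {k k' l : ℕ} (h : Consec S k l) (h' : Consec S k' l) :
    k = k' := by
  rcases lt_trichotomy k k' with e | e | e
  · exact absurd h'.2.1 (h.2.2.2 k' e h'.1)
  · exact e
  · exact absurd h.2.1 (h'.2.2.2 k e h.1)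

theorem exists_consec_right {S : Set ℕ} {k n : ℕ} (hk : k ∈ S) (hn : n ∈ S) (hkn : k < n) :
    ∃ l, Consec S k l := by
  classical
  have hex : ∃ l, k < l ∧ l ∈ S := ⟨n, hkn, hn⟩
  exact ⟨Nat.find hex, (Nat.find_spec hex).1, hk, (Nat.find_spec hex).2,
    fun q h1 h2 h3 => Nat.find_min hex h2 ⟨h1, h3⟩⟩

theorem exists_consec_left {S : Set ℕ} {k n : ℕ} (hk : k ∈ S) (hn : n ∈ S) (hnk : n < k) :
    ∃ i, Consec S i k := by
  classical
  set i := Nat.findGreatest (fun i => i < k ∧ i ∈ S) k with hi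
  have hspec : i < k ∧ i ∈ S := Nat.findGreatest_spec (P := fun i => i < k ∧ i ∈ S) hnk.le ⟨hnk, hn⟩
  refine ⟨i, hspec.1, hspec.2, hk, fun q h1 h2 h3 => ?_⟩
  exact Nat.findGreatest_is_greatest (P := fun i => i < k ∧ i ∈ S) h1 h2.le ⟨h2, h3⟩

/-- If every element is present in a sequence of sets during one interval of times, then the
number of triples of consecutive elements that ever occur is linear. -/
theorem exists_triples (n m : ℕ) (S : ℕ → Set ℕ) (h0 : ∀ j < m, 0 ∈ S j)
    (hn : ∀ j < m, n + 1 ∈ S j) (hS : ∀ j < m, ∀ i ∈ S j, i ≤ n + 1)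
    (hconv : ∀ j₁ j₂ j₃, j₁ ≤ j₂ → j₂ ≤ j₃ → j₃ < m → ∀ i, i ∈ S j₁ → i ∈ S j₃ → i ∈ S j₂) :
    ∃ T : Finset (ℕ × ℕ × ℕ), T.card ≤ 5 * n ∧
      ∀ i k l, (i, k, l) ∈ T ↔ ∃ j < m, Consec (S j) i k ∧ Consec (S j) k l := by
  classical
  set T : Finset (ℕ × ℕ × ℕ) := ((range (n + 2)) ×ˢ (range (n + 2)) ×ˢ (range (n + 2))).filter
    fun t => ∃ j < m, Consec (S j) t.1 t.2.1 ∧ Consec (S j) t.2.1 t.2.2 with hT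
  refine ⟨T, ?_, ?_⟩
  swap
  · intro i k l
    simp only [hT, Finset.mem_filter, Finset.mem_product, Finset.mem_range, and_iff_right_iff_imp]
    rintro ⟨j, hj, h1, h2⟩
    have := hS j hj i h1.2.1
    have := hS j hj k h1.2.2.1
    have := hS j hj l h2.2.2.1
    omega
  -- an element starts, and ends, at most once
  have hstart : ∀ q j j', j < m → j' < m → q ∈ S j → (j = 0 ∨ q ∉ S (j - 1)) → q ∈ S j' →
      (j' = 0 ∨ q ∉ S (j' - 1)) → j = j' := by
    intro q j j' hj hj' h1 h2 h3 h4
    rcases lt_trichotomy j j' with e | e | e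
    · rcases h4 with h4 | h4
      · omega
      · exact absurd (hconv j (j' - 1) j' (by omega) (by omega) hj' q h1 h3) h4
    · exact e
    · rcases h2 with h2 | h2
      · omega
      · exact absurd (hconv j' (j - 1) j (by omega) (by omega) hj q h3 h1) h2
  have hend : ∀ q j j', 0 < j → 0 < j' → j < m → j' < m → q ∈ S (j - 1) → q ∉ S j →
      q ∈ S (j' - 1) → q ∉ S j' → j = j' := by
    intro q j j' hj0 hj0' hj hj' h1 h2 h3 h4
    rcases lt_trichotomy j j' with e | e | e
    · exact absurd (hconv (j - 1) j (j' - 1) (by omega) (by omega) (by omega) q h1 h3) h2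
    · exact e
    · exact absurd (hconv (j' - 1) j' (j - 1) (by omega) (by omega) (by omega) q h3 h1) h4
  -- the event that a triple is charged to
  let R : Fin 5 → ℕ × ℕ × ℕ → ℕ → ℕ → Prop := ![
    fun t j q => q = t.2.1 ∧ (j = 0 ∨ q ∉ S (j - 1)),
    fun t j q => q = t.1 ∧ (j = 0 ∨ q ∉ S (j - 1)),
    fun t j q => q = t.2.2 ∧ (j = 0 ∨ q ∉ S (j - 1)),
    fun t j q => 0 < j ∧ q ∉ S j ∧ Consec (S (j - 1)) q t.2.1,
    fun t j q => 0 < j ∧ q ∉ S j ∧ Consec (S (j - 1)) t.2.1 q]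
  -- At the first time `j` of a triple, either one of its members has just started, or all three
  -- were present before and `k` had a nearer neighbour on one side, which has just ended. The
  -- elements `0` and `n + 1` never start after time `0` and never end, so only `1, …, n` are
  -- charged.
  have hcharge : ∀ t ∈ T, ∃ cq : Fin 5 × ℕ, cq.2 ∈ Finset.Icc 1 n ∧ ∃ j < m,
      Consec (S j) t.1 t.2.1 ∧ Consec (S j) t.2.1 t.2.2 ∧ R cq.1 t j cq.2 := by
    rintro ⟨i, k, l⟩ ht
    have hex := (Finset.mem_filter.1 ht).2
    dsimp only at hex
    obtain ⟨hj, h1, h2⟩ := Nat.find_spec hex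
    have hmin := fun j' => Nat.find_min hex (m := j')
    set j := Nat.find hex
    have hl := hS j hj l h2.2.2.1
    have hik := h1.1
    have hkl := h2.1
    by_cases hk0 : j = 0 ∨ k ∉ S (j - 1)
    · exact ⟨(0, k), by simp; omega, j, hj, h1, h2, rfl, hk0⟩
    push Not at hk0
    obtain ⟨hj0, hkS⟩ := hk0
    have hj1 : j - 1 < m := by omega
    by_cases hi : i ∈ S (j - 1)
    swap
    · refine ⟨(1, i), ?_, j, hj, h1, h2, rfl, Or.inr hi⟩
      have : i ≠ 0 := fun h => hi (h ▸ h0 _ hj1)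
      simp; omega
    by_cases hl' : l ∈ S (j - 1)
    swap
    · refine ⟨(2, l), ?_, j, hj, h1, h2, rfl, Or.inr hl'⟩
      have : l ≠ n + 1 := fun h => hl' (h ▸ hn _ hj1)
      simp; omega
    obtain ⟨p, hp⟩ := exists_consec_left hkS hi h1.1
    obtain ⟨q, hq⟩ := exists_consec_right hkS hl' h2.1
    have hip : i ≤ p := by
      by_contra! h
      exact hp.2.2.2 i h h1.1 hi
    have hql : q ≤ l := by
      by_contra! h
      exact hq.2.2.2 l h2.1 h hl'
    have hpk := hp.1
    have hkq := hq.1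
    rcases hip.eq_or_lt with e | e
    · rcases hql.eq_or_lt with e' | e'
      · subst e e'
        exact absurd ⟨hj1, hp, hq⟩ (hmin (j - 1) (by omega))
      · exact ⟨(4, q), by simp; omega, j, hj, h1, h2, by omega, h2.2.2.2 q hq.1 e', hq⟩
    · exact ⟨(3, p), by simp; omega, j, hj, h1, h2, by omega, h1.2.2.2 p e hp.1, hp⟩
  choose! f hf hfR using hcharge
  have hcard : T.card ≤ ((Finset.univ : Finset (Fin 5)) ×ˢ Finset.Icc 1 n).card := by
    apply Finset.card_le_card_of_injOn f
    · intro t ht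
      have := hf t ht
      simp only [Finset.coe_product, Finset.coe_univ, Set.mem_prod, Set.mem_univ, true_and]
      exact this
    · rintro ⟨i, k, l⟩ ht ⟨i', k', l'⟩ ht' heq
      obtain ⟨j, hj, h1, h2, h3⟩ := hfR _ ht
      obtain ⟨j', hj', h1', h2', h3'⟩ := hfR _ ht'
      rw [← heq] at h3'
      generalize f (i, k, l) = cq at h3 h3'
      obtain ⟨c, q⟩ := cq
      -- The kind of event and its element determine the time; the time then determines the middle
      -- element, hence its neighbours.
      suffices H : j = j' ∧ k = k' by
        obtain ⟨rfl, rfl⟩ := H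
        obtain rfl : i = i' := h1.left_unique h1'
        obtain rfl : l = l' := h2.right_unique h2'
        rfl
      dsimp only at h1 h2 h1' h2' h3 h3'
      fin_cases c
      · obtain ⟨rfl, h⟩ := h3
        obtain ⟨e, h'⟩ := h3'
        dsimp only at e h h'
        subst e
        exact ⟨hstart _ j j' hj hj' h1.2.2.1 h h1'.2.2.1 h', rfl⟩
      · obtain ⟨rfl, h⟩ := h3
        obtain ⟨e, h'⟩ := h3'
        dsimp only at e h h'
        subst e
        have := hstart _ j j' hj hj' h1.2.1 h h1'.2.1 h'
        subst this
        exact ⟨rfl, h1.right_unique h1'⟩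
      · obtain ⟨rfl, h⟩ := h3
        obtain ⟨e, h'⟩ := h3'
        dsimp only at e h h'
        subst e
        have := hstart _ j j' hj hj' h2.2.2.1 h h2'.2.2.1 h'
        subst this
        exact ⟨rfl, h2.left_unique h2'⟩
      · obtain ⟨e1, e2, e3⟩ := h3
        obtain ⟨e1', e2', e3'⟩ := h3'
        have := hend q j j' e1 e1' hj hj' e3.2.1 e2 e3'.2.1 e2'
        subst this
        exact ⟨rfl, e3.right_unique e3'⟩
      · obtain ⟨e1, e2, e3⟩ := h3
        obtain ⟨e1', e2', e3'⟩ := h3'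
        have := hend q j j' e1 e1' hj hj' e3.2.2.1 e2 e3'.2.2.1 e2'
        subst this
        exact ⟨rfl, e3.left_unique e3'⟩
  simpa using hcard

/-! ### Trapezoidal decomposition of an upper envelope -/

/-- The endpoints of finitely many intervals cut `[-1, 1]` into elementary intervals. -/
theorem exists_elementary_intervals (N : ℕ) (I : ℕ → Set ℝ) (hI : ∀ i ≤ N, (I i).OrdConnected) :
    ∃ (m : ℕ) (e : ℕ → ℝ) (Z : Finset ℝ), (∀ j < m, e j < e (j + 1)) ∧
      (∀ j ≤ m, e j ∈ Set.Icc (-1 : ℝ) 1) ∧ (∀ j₁ j₂, j₁ ≤ j₂ → j₂ ≤ m → e j₁ ≤ e j₂) ∧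
      (∀ x ∈ Set.Icc (-1 : ℝ) 1, x ∉ Z → ∃ j < m, x ∈ Set.Ioo (e j) (e (j + 1))) ∧
      ∀ i ≤ N, ∀ j < m, ∀ x ∈ Set.Ioo (e j) (e (j + 1)), ∀ x' ∈ Set.Ioo (e j) (e (j + 1)),
        x ∈ I i → x' ∈ I i := by
  classical
  set J : ℕ → Set ℝ := fun i => I i ∩ Set.Icc (-1) 1 with hJ
  -- For an empty `J i` both `sInf` and `sSup` are `0`, a harmless extra cut.
  set Z : Finset ℝ := insert (-1) (insert 1 (((range (N + 1)).image fun i => sInf (J i)) ∪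
    ((range (N + 1)).image fun i => sSup (J i)))) |>.filter fun z => z ∈ Set.Icc (-1 : ℝ) 1 with hZ
  have hm1 : (-1 : ℝ) ∈ Z := by simp [hZ]
  have hp1 : (1 : ℝ) ∈ Z := by simp [hZ]
  obtain ⟨m, hm⟩ : ∃ m, Z.card = m + 1 :=
    Nat.exists_eq_succ_of_ne_zero (Finset.card_pos.2 ⟨_, hm1⟩).ne'
  set E := Z.orderEmbOfFin hm with hE
  have hEr : ∀ z ∈ Z, ∃ j, E j = z := fun z hz => by
    have : z ∈ Set.range E := by rw [hE, Finset.range_orderEmbOfFin]; exact hz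
    exact this
  set e : ℕ → ℝ := fun j => if h : j < m + 1 then E ⟨j, h⟩ else 1 with he
  have heE : ∀ j (h : j < m + 1), e j = E ⟨j, h⟩ := fun j h => dif_pos h
  have hmono : ∀ j₁ j₂, j₁ ≤ j₂ → j₂ ≤ m → e j₁ ≤ e j₂ := fun j₁ j₂ h1 h2 => by
    rw [heE j₁ (by omega), heE j₂ (by omega)]
    exact E.monotone h1
  have heZ : ∀ j ≤ m, e j ∈ Z := fun j hj => by
    rw [heE j (by omega)]; exact Finset.orderEmbOfFin_mem _ _ _
  have hgap : ∀ z ∈ Z, ∀ j < m, z ∉ Set.Ioo (e j) (e (j + 1)) := by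
    intro z hz j hj hz'
    obtain ⟨i, rfl⟩ := hEr z hz
    rw [heE j (by omega), heE (j + 1) (by omega)] at hz'
    have h1 := E.lt_iff_lt.1 hz'.1
    have h2 := E.lt_iff_lt.1 hz'.2
    simp only [Fin.lt_def] at h1 h2
    omega
  have heIcc : ∀ j ≤ m, e j ∈ Set.Icc (-1 : ℝ) 1 := fun j hj => (Finset.mem_filter.1 (heZ j hj)).2
  refine ⟨m, e, Z, ?_, heIcc, hmono, ?_, ?_⟩
  · intro j hj
    rw [heE j (by omega), heE (j + 1) (by omega)]
    exact E.strictMono (by simp [Fin.lt_def])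
  · intro x hx hxZ
    have hex : ∃ j, j ≤ m ∧ x < e j := by
      obtain ⟨i, hi⟩ := hEr 1 hp1
      refine ⟨i, by omega, ?_⟩
      rw [heE i i.2, Fin.eta, hi]
      exact lt_of_le_of_ne hx.2 fun h => hxZ (h ▸ hp1)
    have hspec := Nat.find_spec hex
    have h0 : Nat.find hex ≠ 0 := fun h => by
      rw [h] at hspec
      obtain ⟨i, hi⟩ := hEr (-1) hm1
      have := hmono 0 i (by omega) (by omega)
      rw [heE i i.2, Fin.eta, hi] at this
      linarith [hx.1, hspec.2]
    obtain ⟨j, hj⟩ := Nat.exists_eq_succ_of_ne_zero h0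
    have hmin := Nat.find_min hex (m := j) (by omega)
    rw [hj] at hspec
    push Not at hmin
    refine ⟨j, by omega, ?_, hspec.2⟩
    exact lt_of_le_of_ne (hmin (by omega)) fun h => hxZ (h ▸ heZ j (by omega))
  · intro i hi j hj x hx x' hx' hxI
    have hx1 : x ∈ J i := ⟨hxI, (heIcc j hj.le).1.trans hx.1.le, hx.2.le.trans (heIcc _ hj).2⟩
    have hbb : BddBelow (J i) := ⟨-1, fun z hz => hz.2.1⟩
    have hba : BddAbove (J i) := ⟨1, fun z hz => hz.2.2⟩
    have hinfZ : sInf (J i) ∈ Z := by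
      simp only [hZ, Finset.mem_filter, Finset.mem_insert, Finset.mem_union, Finset.mem_image,
        Finset.mem_range]
      exact ⟨Or.inr (Or.inr (Or.inl ⟨i, by omega, rfl⟩)), le_csInf ⟨x, hx1⟩ fun z hz => hz.2.1,
        (csInf_le hbb hx1).trans hx1.2.2⟩
    have hsupZ : sSup (J i) ∈ Z := by
      simp only [hZ, Finset.mem_filter, Finset.mem_insert, Finset.mem_union, Finset.mem_image,
        Finset.mem_range]
      exact ⟨Or.inr (Or.inr (Or.inr ⟨i, by omega, rfl⟩)), hx1.2.1.trans (le_csSup hba hx1),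
        csSup_le ⟨x, hx1⟩ fun z hz => hz.2.2⟩
    -- No cut lies inside an elementary interval, so once `J i` meets it, the infimum and supremum
    -- of `J i` lie on either side of it.
    have h1 : sInf (J i) ≤ e j := by
      by_contra! h
      exact hgap _ hinfZ j hj ⟨h, (csInf_le hbb hx1).trans_lt hx.2⟩
    have h2 : e (j + 1) ≤ sSup (J i) := by
      by_contra! h
      exact hgap _ hsupZ j hj ⟨hx.1.trans_le (le_csSup hba hx1), h⟩
    obtain ⟨z₁, hz₁, hz₁'⟩ := exists_lt_of_csInf_lt ⟨x, hx1⟩ (h1.trans_lt hx'.1)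
    obtain ⟨z₂, hz₂, hz₂'⟩ := exists_lt_of_lt_csSup ⟨x, hx1⟩ (hx'.2.trans_le h2)
    exact (hI i hi).out hz₁.1 hz₂.1 ⟨hz₁'.le, hz₂'.le⟩

/-- At a fixed abscissa, a line above its two neighbours among the lines occurring on the upper
envelope is above all lines. -/
theorem le_of_consec (N : ℕ) (U V : ℕ → ℝ) (S : Set ℕ)
    (hS : ∀ i, i ∈ S ↔ i ≤ N ∧ ∃ y, ∀ j ≤ N, U j + V j * y ≤ U i + V i * y)
    (hV : ∀ i ∈ S, ∀ j ∈ S, i < j → V i < V j) {i k l : ℕ} (hik : Consec S i k)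
    (hkl : Consec S k l) {y : ℝ} (h1 : U i + V i * y ≤ U k + V k * y)
    (h2 : U l + V l * y ≤ U k + V k * y) : ∀ j ≤ N, U j + V j * y ≤ U k + V k * y := by
  obtain ⟨M, hM, hmax⟩ := Finset.exists_max_image (range (N + 1)) (fun j => U j + V j * y)
    ⟨0, by simp⟩
  have hmax' : ∀ j ≤ N, U j + V j * y ≤ U M + V M * y := fun j hj => hmax j (by simp; omega)
  have hMN : M ≤ N := by simp at hM; omega
  have hMS : M ∈ S := (hS M).2 ⟨hMN, y, hmax'⟩
  suffices H : U M + V M * y ≤ U k + V k * y from fun j hj => (hmax' j hj).trans H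
  have hkS := hkl.2.1
  have hkM := hmax' k ((hS k).1 hkS).1
  rcases lt_trichotomy M k with e | e | e
  · have hMi : M ≤ i := by
      by_contra! h
      exact hik.2.2.2 M h e hMS
    rcases hMi.eq_or_lt with rfl | h
    · exact h1
    -- Comparing slopes at `y` and at a point `yi` where `i` is maximal gives `y ≤ yi` (from `M` and
    -- `i`) and `yi ≤ y` (from `i` and `k`). Hence `i` is maximal at `y`, and `k` with it.
    · have hiS := hik.2.1
      obtain ⟨yi, hyi⟩ := ((hS i).1 hiS).2
      have e1 := hyi M hMN
      have e2 := hyi k ((hS k).1 hkS).1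
      have e3 := hV M hMS i hiS h
      have e4 := hV i hiS k hkS hik.1
      have e5 : y ≤ yi := by
        by_contra! hlt
        nlinarith [mul_pos (sub_pos.2 hlt) (sub_pos.2 e3)]
      have e6 : yi ≤ y := by
        by_contra! hlt
        nlinarith [mul_pos (sub_pos.2 hlt) (sub_pos.2 e4)]
      obtain rfl := le_antisymm e5 e6
      linarith
  · rw [e]
  · have hMl : l ≤ M := by
      by_contra! h
      exact hkl.2.2.2 M e h hMS
    rcases hMl.eq_or_lt with rfl | h
    · exact h2
    · have hlS := hkl.2.2.1
      obtain ⟨yl, hyl⟩ := ((hS l).1 hlS).2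
      have e1 := hyl M hMN
      have e2 := hyl k ((hS k).1 hkS).1
      have e3 := hV l hlS M hMS h
      have e4 := hV k hkS l hlS hkl.1
      have e5 : yl ≤ y := by
        by_contra! hlt
        nlinarith [mul_pos (sub_pos.2 hlt) (sub_pos.2 e3)]
      have e6 : y ≤ yl := by
        by_contra! hlt
        nlinarith [mul_pos (sub_pos.2 hlt) (sub_pos.2 e4)]
      obtain rfl := le_antisymm e5 e6
      linarith

/-- An affine inequality on two vertical sections of a trapezoid holds between them. -/
theorem affine_nonpos_between (l₀ l₁ h₀ h₁ D₀ D₁ D₂ : ℝ) {x' x'' x y : ℝ} (hx' : x' < x)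
    (hx'' : x < x'') (hl' : l₀ + l₁ * x' ≤ h₀ + h₁ * x') (hl'' : l₀ + l₁ * x'' ≤ h₀ + h₁ * x'')
    (H' : ∀ y, l₀ + l₁ * x' ≤ y → y ≤ h₀ + h₁ * x' → D₀ + D₁ * x' + D₂ * y ≤ 0)
    (H'' : ∀ y, l₀ + l₁ * x'' ≤ y → y ≤ h₀ + h₁ * x'' → D₀ + D₁ * x'' + D₂ * y ≤ 0)
    (hy : l₀ + l₁ * x ≤ y) (hy' : y ≤ h₀ + h₁ * x) : D₀ + D₁ * x + D₂ * y ≤ 0 := by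
  obtain ⟨s, hs, rfl⟩ := exists_mem_Icc_eq hy hy'
  -- Points dividing the vertical sections in a fixed ratio `s` lie on a straight line, so the
  -- middle value is a convex combination of the outer two.
  have e1 := H' (l₀ + l₁ * x' + s * ((h₀ + h₁ * x') - (l₀ + l₁ * x')))
    (by nlinarith [hs.1]) (by nlinarith [hs.2])
  have e2 := H'' (l₀ + l₁ * x'' + s * ((h₀ + h₁ * x'') - (l₀ + l₁ * x'')))
    (by nlinarith [hs.1]) (by nlinarith [hs.2])
  have e3 := mul_nonpos_of_nonneg_of_nonpos (sub_pos.2 hx'').le e1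
  have e4 := mul_nonpos_of_nonneg_of_nonpos (sub_pos.2 hx').le e2
  have e5 : (x'' - x') * (D₀ + D₁ * x + D₂ * (l₀ + l₁ * x + s * (h₀ + h₁ * x - (l₀ + l₁ * x))))
      ≤ 0 := by linarith
  exact nonpos_of_mul_nonpos_right e5 (by linarith)

/-- The upper envelope of `n` affine functions over a square splits into `5 n` trapezoids on each of
which one function is maximal. The functions are sorted by slope, with two steep ones added. -/
theorem exists_trapezoids_sorted (n : ℕ) (A B Γ : ℕ → ℝ)
    (hmono : ∀ i j, i < j → j ≤ n + 1 → Γ i ≤ Γ j)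
    (hinj : ∀ i j, i < j → j ≤ n + 1 → Γ i = Γ j → B i = B j → A i = A j → False)
    (hA : ∀ i, 1 ≤ i → i ≤ n → |A i| ≤ 1) (hB : ∀ i, 1 ≤ i → i ≤ n → |B i| ≤ 1)
    (hΓ : ∀ i, 1 ≤ i → i ≤ n → |Γ i| ≤ 1)
    (hA0 : A 0 = -110) (hB0 : B 0 = 0) (hΓ0 : Γ 0 = -100)
    (hAn : A (n + 1) = -110) (hBn : B (n + 1) = 0) (hΓn : Γ (n + 1) = 100) :
    ∃ (T : Finset (ℕ × Trapezoid)) (Z : Finset ℝ), T.card ≤ 5 * n ∧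
      (∀ t ∈ T, 1 ≤ t.1 ∧ t.1 ≤ n ∧ (∀ x, t.2.a < x → x < t.2.b → t.2.lo x ≤ t.2.hi x) ∧
        ∀ x y, t.2.Mem x y → x ∈ Set.Icc (-1 : ℝ) 1 ∧ y ∈ Set.Icc (-2 : ℝ) 2 ∧
          ∀ j, 1 ≤ j → j ≤ n → A j + B j * x + Γ j * y ≤ A t.1 + B t.1 * x + Γ t.1 * y) ∧
      ∀ x ∈ Set.Icc (-1 : ℝ) 1, x ∉ Z → ∀ y ∈ Set.Icc (-1 : ℝ) 1, 1 ≤ n → ∃ t ∈ T, t.2.Mem x y := by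
  classical
  set I : ℕ → Set ℝ := fun i =>
    {x | ∃ y, ∀ j ≤ n + 1, (A j + B j * x) + Γ j * y ≤ (A i + B i * x) + Γ i * y} with hI
  have hIord : ∀ i ≤ n + 1, (I i).OrdConnected := by
    intro i hi
    -- `I i` is the projection of the convex cell on which function `i` is maximal.
    have : Convex ℝ (I i) := by
      rintro x ⟨y, hy⟩ x' ⟨y', hy'⟩ s t hs ht hst
      refine ⟨s * y + t * y', fun j hj => ?_⟩
      have e1 := mul_le_mul_of_nonneg_left (hy j hj) hs
      have e2 := mul_le_mul_of_nonneg_left (hy' j hj) ht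
      obtain rfl : t = 1 - s := by linarith
      simp only [smul_eq_mul]
      linarith
    exact this.ordConnected
  obtain ⟨m, e, Z, he, heIcc, hemono, hcov, hunif⟩ := exists_elementary_intervals (n + 1) I hIord
  set S : ℕ → Set ℕ := fun j => {i | i ≤ n + 1 ∧ Set.Ioo (e j) (e (j + 1)) ⊆ I i} with hS
  have hSmem : ∀ j < m, ∀ x ∈ Set.Ioo (e j) (e (j + 1)), ∀ i, i ∈ S j ↔ i ≤ n + 1 ∧ x ∈ I i :=
    fun j hj x hx i => ⟨fun h => ⟨h.1, h.2 hx⟩,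
      fun h => ⟨h.1, fun x' hx' => hunif i h.1 j hj x hx x' hx' h.2⟩⟩
  have hIoo : ∀ j < m, ∀ x ∈ Set.Ioo (e j) (e (j + 1)), x ∈ Set.Icc (-1 : ℝ) 1 :=
    fun j hj x hx => ⟨(heIcc j hj.le).1.trans hx.1.le, hx.2.le.trans (heIcc (j + 1) hj).2⟩
  have hbd : ∀ i, 1 ≤ i → i ≤ n → ∀ x ∈ Set.Icc (-1 : ℝ) 1, |A i + B i * x| ≤ 2 := by
    intro i h1 h2 x hx
    have e1 := hA i h1 h2
    have e2 : |B i * x| ≤ 1 := by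
      rw [abs_mul]; exact mul_le_one₀ (hB i h1 h2) (abs_nonneg _) (abs_le.2 hx)
    exact (abs_add_le _ _).trans (by linarith)
  -- The steep functions are `-110 ∓ 100 y`. At `y = -2` the first is `90`, the others at most `4`,
  -- so it always occurs on the envelope; for `|y| ≤ 1` both are at most `-10`, below every original
  -- function.
  have h0S : ∀ j < m, 0 ∈ S j := fun j hj => ⟨by omega, fun x hx => ⟨-2, fun i hi => by
    have hx' := hIoo j hj x hx
    rcases Nat.eq_zero_or_pos i with rfl | h
    · exact le_rfl
    rcases hi.eq_or_lt with rfl | h'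
    · rw [hA0, hB0, hΓ0, hAn, hBn, hΓn]; norm_num
    · have e1 := abs_le.1 (hbd i h (by omega) x hx')
      have e2 := abs_le.1 (hΓ i h (by omega))
      rw [hA0, hB0, hΓ0]; linarith [e1.2, e2.1]⟩⟩
  have hnS : ∀ j < m, n + 1 ∈ S j := fun j hj => ⟨le_rfl, fun x hx => ⟨2, fun i hi => by
    have hx' := hIoo j hj x hx
    rcases Nat.eq_zero_or_pos i with rfl | h
    · rw [hA0, hB0, hΓ0, hAn, hBn, hΓn]; norm_num
    rcases hi.eq_or_lt with rfl | h'
    · exact le_rfl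
    · have e1 := abs_le.1 (hbd i h (by omega) x hx')
      have e2 := abs_le.1 (hΓ i h (by omega))
      rw [hAn, hBn, hΓn]; linarith [e1.2, e2.2]⟩⟩
  have hmid : ∀ j < m, (e j + e (j + 1)) / 2 ∈ Set.Ioo (e j) (e (j + 1)) := fun j hj => by
    have := he j hj
    exact ⟨by linarith, by linarith⟩
  obtain ⟨T₀, hT₀c, hT₀⟩ := exists_triples n m S h0S hnS (fun j _ i hi => hi.1) (by
    intro j₁ j₂ j₃ h12 h23 h3 i hi1 hi3
    rcases h12.eq_or_lt with rfl | h12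
    · exact hi1
    rcases h23.eq_or_lt with rfl | h23
    · exact hi3
    refine ⟨hi1.1, fun x hx => ?_⟩
    have m1 := hmid j₁ (by omega)
    have m3 := hmid j₃ (by omega)
    refine (hIord i hi1.1).out (hi1.2 m1) (hi3.2 m3) ⟨?_, ?_⟩
    · linarith [m1.2, hx.1, hemono (j₁ + 1) j₂ (by omega) (by omega)]
    · linarith [m3.1, hx.2, hemono (j₂ + 1) j₃ (by omega) (by omega)])
  -- slopes of lines occurring simultaneously are distinct
  have hslope : ∀ j < m, ∀ i ∈ S j, ∀ l ∈ S j, i < l → Γ i < Γ l := by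
    intro j hj i hi l hl hil
    refine lt_of_le_of_ne (hmono i l hil hl.1) fun heq => ?_
    -- Parallel lines that both occur on the envelope coincide; two abscissas then force the two
    -- functions to be equal.
    have heqx : ∀ x ∈ Set.Ioo (e j) (e (j + 1)), A i + B i * x = A l + B l * x := by
      intro x hx
      obtain ⟨y, hy⟩ := hi.2 hx
      obtain ⟨y', hy'⟩ := hl.2 hx
      have e1 := hy l hl.1
      have e2 := hy' i hi.1
      rw [heq] at e1 e2
      linarith
    have hlt := he j hj
    have e1 := heqx ((e j + e (j + 1)) / 2) (hmid j hj)
    have e2 := heqx ((2 * e j + e (j + 1)) / 3) ⟨by linarith, by linarith⟩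
    have hBeq : B i = B l := by
      have : (B i - B l) * (e (j + 1) - e j) = 0 := by linarith
      rcases mul_eq_zero.1 this with h | h <;> linarith
    refine hinj i l hil hl.1 heq hBeq ?_
    rw [hBeq] at e1
    linarith
  -- the trapezoid of a triple
  set lo₀ : ℕ × ℕ × ℕ → ℝ := fun t => -(A t.2.1 - A t.1) / (Γ t.2.1 - Γ t.1) with hlo₀
  set lo₁ : ℕ × ℕ × ℕ → ℝ := fun t => -(B t.2.1 - B t.1) / (Γ t.2.1 - Γ t.1) with hlo₁
  set hi₀ : ℕ × ℕ × ℕ → ℝ := fun t => -(A t.2.2 - A t.2.1) / (Γ t.2.2 - Γ t.2.1) with hhi₀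
  set hi₁ : ℕ × ℕ × ℕ → ℝ := fun t => -(B t.2.2 - B t.2.1) / (Γ t.2.2 - Γ t.2.1) with hhi₁
  have hlo_iff : ∀ i k l, Γ i < Γ k → ∀ x y, lo₀ (i, k, l) + lo₁ (i, k, l) * x ≤ y ↔
      (A i + B i * x) + Γ i * y ≤ (A k + B k * x) + Γ k * y := by
    intro i k l h x y
    have : 0 < Γ k - Γ i := by linarith
    simp only [hlo₀, hlo₁]
    rw [div_mul_eq_mul_div, ← add_div, div_le_iff₀ this]
    constructor <;> intro h <;> linarith
  have hhi_iff : ∀ i k l, Γ k < Γ l → ∀ x y, y ≤ hi₀ (i, k, l) + hi₁ (i, k, l) * x ↔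
      (A l + B l * x) + Γ l * y ≤ (A k + B k * x) + Γ k * y := by
    intro i k l h x y
    have : 0 < Γ l - Γ k := by linarith
    simp only [hhi₀, hhi₁]
    rw [div_mul_eq_mul_div, ← add_div, le_div_iff₀ this]
    constructor <;> intro h <;> linarith
  -- behaviour on a generic vertical line
  have hgen : ∀ i k l, ∀ j < m, Consec (S j) i k → Consec (S j) k l →
      ∀ x ∈ Set.Ioo (e j) (e (j + 1)),
      lo₀ (i, k, l) + lo₁ (i, k, l) * x ≤ hi₀ (i, k, l) + hi₁ (i, k, l) * x ∧
      ∀ y, lo₀ (i, k, l) + lo₁ (i, k, l) * x ≤ y → y ≤ hi₀ (i, k, l) + hi₁ (i, k, l) * x →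
        y ∈ Set.Icc (-2 : ℝ) 2 ∧ ∀ q ≤ n + 1, (A q + B q * x) + Γ q * y ≤
          (A k + B k * x) + Γ k * y := by
    intro i k l j hj h1 h2 x hx
    have hx' := hIoo j hj x hx
    have s1 := hslope j hj i h1.2.1 k h1.2.2.1 h1.1
    have s2 := hslope j hj k h1.2.2.1 l h2.2.2.1 h2.1
    refine ⟨?_, ?_⟩
    · obtain ⟨y, hy⟩ := h1.2.2.1.2 hx
      exact ((hlo_iff i k l s1 x y).2 (hy i h1.2.1.1)).trans
        ((hhi_iff i k l s2 x y).2 (hy l h2.2.2.1.1))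
    · intro y hy1 hy2
      have hall := le_of_consec (n + 1) (fun i => A i + B i * x) Γ (S j) (hSmem j hj x hx)
        (hslope j hj) h1 h2 ((hlo_iff i k l s1 x y).1 hy1) ((hhi_iff i k l s2 x y).1 hy2)
      refine ⟨?_, hall⟩
      have hk1 : 1 ≤ k := by have := h1.1; omega
      have hkn : k ≤ n := by have := h2.1; have := h2.2.2.1.1; omega
      have e1 := abs_le.1 (hbd k hk1 hkn x hx')
      have e2 := abs_le.1 (hΓ k hk1 hkn)
      have e3 := hall 0 (by omega)
      have e4 := hall (n + 1) le_rfl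
      simp only [hA0, hB0, hΓ0, hAn, hBn, hΓn] at e3 e4
      constructor
      · by_contra! h
        nlinarith [e1.2, e2.1]
      · by_contra! h
        nlinarith [e1.2, e2.2]
  -- first and last occurrence
  have hfl : ∀ t ∈ T₀, ∃ j₁ j₂, j₁ < m ∧ j₂ < m ∧ Consec (S j₁) t.1 t.2.1 ∧
      Consec (S j₁) t.2.1 t.2.2 ∧ Consec (S j₂) t.1 t.2.1 ∧ Consec (S j₂) t.2.1 t.2.2 ∧
      ∀ j < m, Consec (S j) t.1 t.2.1 → Consec (S j) t.2.1 t.2.2 → j₁ ≤ j ∧ j ≤ j₂ := by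
    rintro ⟨i, k, l⟩ ht
    set F := (range m).filter fun j => Consec (S j) i k ∧ Consec (S j) k l with hF
    have hFne : F.Nonempty := by
      obtain ⟨j, hj, h⟩ := (hT₀ i k l).1 ht
      exact ⟨j, by simp [hF, hj, h]⟩
    have h1 := Finset.min'_mem F hFne
    have h2 := Finset.max'_mem F hFne
    simp only [hF, Finset.mem_filter, Finset.mem_range] at h1 h2
    refine ⟨F.min' hFne, F.max' hFne, h1.1, h2.1, h1.2.1, h1.2.2, h2.2.1, h2.2.2, ?_⟩
    intro j hj h3 h4
    have : j ∈ F := by simp [hF, hj, h3, h4]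
    exact ⟨Finset.min'_le _ _ this, Finset.le_max' _ _ this⟩
  choose! J₁ J₂ hJ₁ hJ₂ hc₁ hc₁' hc₂ hc₂' hJ using hfl
  -- One trapezoid per triple, from its first to its last occurrence. The triple need not stay
  -- consecutive in between: convexity carries the required inequalities across.
  set trap : ℕ × ℕ × ℕ → Trapezoid := fun t =>
    ⟨e (J₁ t), e (J₂ t + 1), lo₀ t, lo₁ t, hi₀ t, hi₁ t⟩ with htrap
  refine ⟨T₀.image fun t => (t.2.1, trap t), Z, Finset.card_image_le.trans hT₀c, ?_, ?_⟩
  · intro t' ht'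
    obtain ⟨⟨i, k, l⟩, ht, rfl⟩ := Finset.mem_image.1 ht'
    have hk : 1 ≤ k ∧ k ≤ n := by
      have h1 := hc₁ _ ht
      have h2 := hc₁' _ ht
      have := h1.1
      have := h2.1
      have := h2.2.2.1.1
      dsimp only at *
      omega
    -- generic abscissas on both sides
    have hsides : ∀ x, e (J₁ (i, k, l)) < x → x < e (J₂ (i, k, l) + 1) → ∃ x' x'', x' < x ∧ x < x'' ∧
        x' ∈ Set.Ioo (e (J₁ (i, k, l))) (e (J₁ (i, k, l) + 1)) ∧
        x'' ∈ Set.Ioo (e (J₂ (i, k, l))) (e (J₂ (i, k, l) + 1)) := by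
      intro x hx1 hx2
      obtain ⟨x', h1, h2⟩ := exists_between (lt_min hx1 (he _ (hJ₁ _ ht)))
      obtain ⟨x'', h3, h4⟩ := exists_between (max_lt hx2 (he _ (hJ₂ _ ht)))
      exact ⟨x', x'', h2.trans_le (min_le_left _ _), (le_max_left _ _).trans_lt h3,
        ⟨h1, h2.trans_le (min_le_right _ _)⟩, ⟨(le_max_right _ _).trans_lt h3, h4⟩⟩
    refine ⟨hk.1, hk.2, ?_, ?_⟩
    · intro x hx1 hx2
      simp only [htrap, Trapezoid.lo, Trapezoid.hi] at hx1 hx2 ⊢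
      obtain ⟨x', x'', h1, h2, h3, h4⟩ := hsides x hx1 hx2
      have g1 := (hgen i k l _ (hJ₁ _ ht) (hc₁ _ ht) (hc₁' _ ht) x' h3).1
      have g2 := (hgen i k l _ (hJ₂ _ ht) (hc₂ _ ht) (hc₂' _ ht) x'' h4).1
      have e3 := mul_nonneg (sub_pos.2 h2).le (sub_nonneg.2 g1)
      have e4 := mul_nonneg (sub_pos.2 h1).le (sub_nonneg.2 g2)
      have e5 : 0 ≤ (x'' - x') * ((hi₀ (i, k, l) + hi₁ (i, k, l) * x) -
          (lo₀ (i, k, l) + lo₁ (i, k, l) * x)) := by linarith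
      have := nonneg_of_mul_nonneg_right e5 (by linarith)
      linarith
    · rintro x y ⟨hx1, hx2, hy1, hy2⟩
      simp only [htrap, Trapezoid.lo, Trapezoid.hi] at hx1 hx2 hy1 hy2 ⊢
      obtain ⟨x', x'', h1, h2, h3, h4⟩ := hsides x hx1 hx2
      have g1 := hgen i k l _ (hJ₁ _ ht) (hc₁ _ ht) (hc₁' _ ht) x' h3
      have g2 := hgen i k l _ (hJ₂ _ ht) (hc₂ _ ht) (hc₂' _ ht) x'' h4
      have hbet : ∀ D₀ D₁ D₂ : ℝ,
          (∀ x y, y ∈ Set.Icc (-2 : ℝ) 2 → (∀ q ≤ n + 1, (A q + B q * x) + Γ q * y ≤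
            (A k + B k * x) + Γ k * y) → D₀ + D₁ * x + D₂ * y ≤ 0) → D₀ + D₁ * x + D₂ * y ≤ 0 :=
        fun D₀ D₁ D₂ H => affine_nonpos_between _ _ _ _ D₀ D₁ D₂ h1 h2 g1.1 g2.1
          (fun y hy hy' => H x' y (g1.2 y hy hy').1 (g1.2 y hy hy').2)
          (fun y hy hy' => H x'' y (g2.2 y hy hy').1 (g2.2 y hy hy').2) hy1 hy2
      refine ⟨⟨(heIcc _ (hJ₁ _ ht).le).1.trans hx1.le,
        hx2.le.trans (heIcc _ (hJ₂ _ ht)).2⟩, ⟨?_, ?_⟩, fun q hq1 hq2 => ?_⟩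
      · linarith [hbet (-2) 0 (-1) fun x y hy _ => by linarith [hy.1]]
      · linarith [hbet (-2) 0 1 fun x y hy _ => by linarith [hy.2]]
      · linarith [hbet (A q - A k) (B q - B k) (Γ q - Γ k) fun x y _ h => by
          linarith [h q (by omega)]]
  · intro x hx hxZ y hy hn1
    obtain ⟨j, hj, hxj⟩ := hcov x hx hxZ
    obtain ⟨k, hk, hmax⟩ := Finset.exists_max_image (range (n + 2))
      (fun j => (A j + B j * x) + Γ j * y) ⟨0, by simp⟩
    have hmax' : ∀ q ≤ n + 1, (A q + B q * x) + Γ q * y ≤ (A k + B k * x) + Γ k * y :=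
      fun q hq => hmax q (by simp; omega)
    have hkn : k ≤ n + 1 := by simp at hk; omega
    have hkS : k ∈ S j := (hSmem j hj x hxj k).2 ⟨hkn, y, hmax'⟩
    have h1 := hmax' 1 (by omega)
    have e1 := abs_le.1 (hbd 1 le_rfl hn1 x hx)
    have e2 := abs_le.1 (hΓ 1 le_rfl hn1)
    -- Over the square, function `1` is at least `-3` and beats both steep functions, so the maximal
    -- `k` has neighbours on both sides.
    have hk0 : 0 < k := by
      rcases Nat.eq_zero_or_pos k with rfl | h
      · rw [hA0, hB0, hΓ0] at h1
        nlinarith [hy.1, hy.2, e1.1, e2.1, e2.2]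
      · exact h
    have hkn' : k < n + 1 := by
      rcases hkn.eq_or_lt with rfl | h
      · rw [hAn, hBn, hΓn] at h1
        nlinarith [hy.1, hy.2, e1.1, e2.1, e2.2]
      · exact h
    obtain ⟨i, hi⟩ := exists_consec_left hkS (h0S j hj) hk0
    obtain ⟨l, hl⟩ := exists_consec_right hkS (hnS j hj) hkn'
    have ht : (i, k, l) ∈ T₀ := (hT₀ i k l).2 ⟨j, hj, hi, hl⟩
    have hJj := hJ _ ht j hj hi hl
    refine ⟨_, Finset.mem_image_of_mem _ ht, ?_, ?_, ?_, ?_⟩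
    · exact (hemono _ _ hJj.1 (by omega)).trans_lt hxj.1
    · exact hxj.2.trans_le (hemono _ _ (by omega) (hJ₂ _ ht))
    · exact (hlo_iff i k l (hslope j hj i hi.2.1 k hkS hi.1) x y).2 (hmax' i hi.2.1.1)
    · exact (hhi_iff i k l (hslope j hj k hkS l hl.2.2.1 hl.1) x y).2 (hmax' l hl.2.2.1.1)

/-- The upper envelope of `n` affine functions over a square splits into `5 n` trapezoids on each of
which one function is maximal. -/
theorem exists_trapezoids {ι : Type*} (K : Finset ι) (hK : K.Nonempty) (α β γ : ι → ℝ)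
    (hinj : Set.InjOn (fun k => (α k, β k, γ k)) K) (hα : ∀ k ∈ K, |α k| ≤ 1)
    (hβ : ∀ k ∈ K, |β k| ≤ 1) (hγ : ∀ k ∈ K, |γ k| ≤ 1) :
    ∃ (T : Finset (ι × Trapezoid)) (Z : Finset ℝ), T.card ≤ 5 * K.card ∧
      (∀ t ∈ T, t.1 ∈ K ∧ (∀ x, t.2.a < x → x < t.2.b → t.2.lo x ≤ t.2.hi x) ∧
        ∀ x y, t.2.Mem x y → x ∈ Set.Icc (-1 : ℝ) 1 ∧ y ∈ Set.Icc (-2 : ℝ) 2 ∧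
          ∀ k ∈ K, α k + β k * x + γ k * y ≤ α t.1 + β t.1 * x + γ t.1 * y) ∧
      ∀ x ∈ Set.Icc (-1 : ℝ) 1, x ∉ Z → ∀ y ∈ Set.Icc (-1 : ℝ) 1, ∃ t ∈ T, t.2.Mem x y := by
  classical
  set n := K.card with hn
  set σ := Tuple.sort fun i : Fin n => γ (K.equivFin.symm i) with hσ
  have hsort : Monotone fun i : Fin n => γ (K.equivFin.symm (σ i)) :=
    Tuple.monotone_sort fun i : Fin n => γ (K.equivFin.symm i)
  obtain ⟨k₀, hk₀⟩ := hK
  -- The shift by one frees the indices `0` and `n + 1` for the steep functions.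
  set g : ℕ → ι := fun i => if h : i - 1 < n then K.equivFin.symm (σ ⟨i - 1, h⟩) else k₀ with hg
  have hgv : ∀ i (h : i - 1 < n), g i = K.equivFin.symm (σ ⟨i - 1, h⟩) := fun i h => dif_pos h
  have hgK : ∀ i, g i ∈ K := fun i => by
    by_cases h : i - 1 < n
    · rw [hgv i h]; exact Subtype.prop _
    · rw [show g i = k₀ from dif_neg h]; exact hk₀
  have hgsurj : ∀ k ∈ K, ∃ i, 1 ≤ i ∧ i ≤ n ∧ g i = k := fun k hk => by
    obtain ⟨j, hj⟩ := σ.surjective (K.equivFin ⟨k, hk⟩)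
    refine ⟨j + 1, by omega, by omega, ?_⟩
    rw [hgv _ (by simp)]
    simp [hj]
  have hginj : ∀ i j, 1 ≤ i → i < j → j ≤ n → g i ≠ g j := fun i j h1 h2 h3 heq => by
    rw [hgv i (by omega), hgv j (by omega)] at heq
    have := σ.injective (K.equivFin.symm.injective (Subtype.ext heq))
    simp only [Fin.mk.injEq] at this
    omega
  set ext : ℝ → (ι → ℝ) → ℝ → ℕ → ℝ := fun u f v i =>
    if i = 0 then u else if i ≤ n then f (g i) else v with hext
  have ext0 : ∀ u f v, ext u f v 0 = u := fun u f v => by simp [hext]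
  have extn : ∀ u f v, ext u f v (n + 1) = v := fun u f v => by simp [hext]
  have exti : ∀ u f v i, 1 ≤ i → i ≤ n → ext u f v i = f (g i) := fun u f v i h1 h2 => by
    have : i ≠ 0 := by omega
    simp [hext, this, h2]
  have hΓ1 : ∀ i, |γ (g i)| ≤ 1 := fun i => hγ _ (hgK i)
  obtain ⟨T, Z, hTc, hT, hcov⟩ := exists_trapezoids_sorted n (ext (-110) α (-110)) (ext 0 β 0)
    (ext (-100) γ 100) (by
      intro i j hij hj
      rcases Nat.eq_zero_or_pos i with rfl | hi
      · rw [ext0]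
        rcases hj.eq_or_lt with rfl | hj'
        · rw [extn]; norm_num
        · rw [exti _ _ _ j (by omega) (by omega)]; linarith [(abs_le.1 (hΓ1 j)).1]
      rw [exti _ _ _ i (by omega) (by omega)]
      rcases hj.eq_or_lt with rfl | hj'
      · rw [extn]; linarith [(abs_le.1 (hΓ1 i)).2]
      · rw [exti _ _ _ j (by omega) (by omega), hgv i (by omega), hgv j (by omega)]
        exact hsort (by simp only [Fin.mk_le_mk]; omega))
    (by
      intro i j hij hj hγe hβe hαe
      rcases Nat.eq_zero_or_pos i with rfl | hi
      · rw [ext0] at hγe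
        rcases hj.eq_or_lt with rfl | hj'
        · rw [extn] at hγe; norm_num at hγe
        · rw [exti _ _ _ j (by omega) (by omega)] at hγe; linarith [(abs_le.1 (hΓ1 j)).1]
      rw [exti _ _ _ i (by omega) (by omega)] at hγe hβe hαe
      rcases hj.eq_or_lt with rfl | hj'
      · rw [extn] at hγe; linarith [(abs_le.1 (hΓ1 i)).2]
      · rw [exti _ _ _ j (by omega) (by omega)] at hγe hβe hαe
        exact hginj i j hi hij (by omega) (hinj (hgK i) (hgK j) (by simp [hγe, hβe, hαe])))
    (fun i h1 h2 => by rw [exti _ _ _ i h1 h2]; exact hα _ (hgK i))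
    (fun i h1 h2 => by rw [exti _ _ _ i h1 h2]; exact hβ _ (hgK i))
    (fun i h1 h2 => by rw [exti _ _ _ i h1 h2]; exact hγ _ (hgK i))
    (ext0 _ _ _) (ext0 _ _ _) (ext0 _ _ _) (extn _ _ _) (extn _ _ _) (extn _ _ _)
  refine ⟨T.image fun t => (g t.1, t.2), Z, Finset.card_image_le.trans hTc, ?_, ?_⟩
  · intro t' ht'
    obtain ⟨t, ht, rfl⟩ := Finset.mem_image.1 ht'
    obtain ⟨h1, h2, h3, h4⟩ := hT t ht
    refine ⟨hgK _, h3, fun x y hxy => ?_⟩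
    obtain ⟨h5, h6, h7⟩ := h4 x y hxy
    refine ⟨h5, h6, fun k hk => ?_⟩
    obtain ⟨i, hi1, hi2, rfl⟩ := hgsurj k hk
    simpa only [exti _ _ _ _ h1 h2, exti _ _ _ _ hi1 hi2] using h7 i hi1 hi2
  · intro x hx hxZ y hy
    obtain ⟨t, ht, h⟩ := hcov x hx hxZ y hy (Finset.card_pos.2 ⟨k₀, hk₀⟩)
    exact ⟨_, Finset.mem_image_of_mem _ ht, h⟩

/-! ### From trapezoids to the square and the cube of directions -/

/-- If a set `K` of affine functions approximates the maximum of a finite set `P` of affine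
functions to `ε`, then `O(|K| log(1/ε))` elements of `P` approximate it to `ε / 24` on a smaller
square. -/
theorem exists_subset_square {ι : Type*} (P K : Finset ι) (hK : K.Nonempty) (hKP : K ⊆ P)
    (α β γ : ι → ℝ) (hinj : Set.InjOn (fun k => (α k, β k, γ k)) K) (hα : ∀ p ∈ P, |α p| ≤ 1)
    (hβ : ∀ p ∈ P, |β p| ≤ 1) (hγ : ∀ p ∈ P, |γ p| ≤ 1) {ε : ℝ} (hε : 0 < ε) (A : ℕ)
    (hA : (8 / ε + 1) * (999 / 1000 : ℝ) ^ A ≤ 1 / 100)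
    (happ : ∀ x ∈ Set.Icc (-1 : ℝ) 1, ∀ y ∈ Set.Icc (-2 : ℝ) 2, ∀ p ∈ P, ∃ k ∈ K,
      α p + β p * x + γ p * y ≤ α k + β k * x + γ k * y + ε) :
    ∃ P' ⊆ P, P'.card ≤ 2020 * (A + 1) * K.card ∧
      ∀ x ∈ Set.Icc (-1 : ℝ) 1, ∀ y ∈ Set.Icc (-1 : ℝ) 1, ∀ p ∈ P, ∃ q ∈ P',
        α p + β p * x + γ p * y ≤ α q + β q * x + γ q * y + ε / 24 := by
  classical
  obtain ⟨T, Z, hTc, hT, hcov⟩ := exists_trapezoids K hK α β γ hinj (fun k hk => hα k (hKP hk))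
    (fun k hk => hβ k (hKP hk)) (fun k hk => hγ k (hKP hk))
  have hbd : ∀ p ∈ P, ∀ x ∈ Set.Icc (-1 : ℝ) 1, ∀ y ∈ Set.Icc (-2 : ℝ) 2,
      |α p + β p * x + γ p * y| ≤ 4 := by
    intro p hp x hx y hy
    have e1 : |β p * x| ≤ 1 := by
      rw [abs_mul]; exact mul_le_one₀ (hβ p hp) (abs_nonneg _) (abs_le.2 hx)
    have e2 : |γ p * y| ≤ 1 * 2 := by
      rw [abs_mul]; exact mul_le_mul (hγ p hp) (abs_le.2 hy) (abs_nonneg _) zero_le_one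
    exact (abs_add_three _ _ _).trans (by linarith [hα p hp])
  have hex : ∀ t ∈ T, ∃ P' ⊆ P, P'.card ≤ 404 * (A + 1) ∧ ∀ x y, t.2.Mem x y → ∀ p ∈ P, ∃ q ∈ P',
      α p + β p * x + γ p * y ≤ α q + β q * x + γ q * y + ε / 24 := by
    intro t ht
    obtain ⟨h1, h2, h3⟩ := hT t ht
    -- All functions are at most `4` in absolute value for `|x| ≤ 1`, `|y| ≤ 2`, so `M = 8`.
    -- Trapezoids may reach `|y| = 2`, which is why `happ` is assumed on the taller rectangle.
    refine exists_subset_trapezoid P α β γ t.2 h2 (hKP h1) hε A hA fun x y hxy p hp => ?_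
    obtain ⟨h4, h5, h6⟩ := h3 x y hxy
    obtain ⟨k, hk, hle⟩ := happ x h4 y h5 p hp
    have e1 := abs_le.1 (hbd p hp x h4 y h5)
    have e2 := abs_le.1 (hbd t.1 (hKP h1) x h4 y h5)
    exact ⟨by linarith [e1.1, e2.2], by linarith [h6 k hk]⟩
  choose! g hgP hgc hg using hex
  refine ⟨T.biUnion g, Finset.biUnion_subset.2 hgP, ?_, ?_⟩
  · calc (T.biUnion g).card ≤ ∑ t ∈ T, (g t).card := Finset.card_biUnion_le
      _ ≤ ∑ t ∈ T, 404 * (A + 1) := Finset.sum_le_sum hgc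
      _ = T.card * (404 * (A + 1)) := by simp
      _ ≤ (5 * K.card) * (404 * (A + 1)) := Nat.mul_le_mul_right _ hTc
      _ = _ := by ring
  · intro x hx y hy p hp
    by_contra! hcon
    -- Failure is an open condition in `x`, so it would also occur at some `x' ∉ Z`, where the
    -- trapezoids do cover.
    have hopen : IsOpen {x | ∀ q ∈ T.biUnion g,
        α q + β q * x + γ q * y + ε / 24 < α p + β p * x + γ p * y} := by
      have : {x | ∀ q ∈ T.biUnion g, α q + β q * x + γ q * y + ε / 24 < α p + β p * x + γ p * y} =
          ⋂ q ∈ T.biUnion g, {x | α q + β q * x + γ q * y + ε / 24 < α p + β p * x + γ p * y} := by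
        ext; simp
      rw [this]
      exact isOpen_biInter_finset fun q _ => isOpen_lt (by fun_prop) (by fun_prop)
    have hcl : x ∈ closure (Set.Ioo (-1 : ℝ) 1) := by
      rw [closure_Ioo (by norm_num)]; exact hx
    have hne := mem_closure_iff.1 hcl _ hopen hcon
    obtain ⟨x', hx', -, hxZ⟩ := (dense_univ.sdiff_finset Z).inter_open_nonempty _
      (hopen.inter isOpen_Ioo) hne
    obtain ⟨t, ht, hmem⟩ := hcov x' ⟨hx'.2.1.le, hx'.2.2.le⟩ (by simpa using hxZ) y hy
    obtain ⟨q, hq, hle⟩ := hg t ht x' y hmem p hp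
    exact absurd (hx'.1 q (Finset.mem_biUnion.2 ⟨t, ht, hq⟩)) (by linarith)

/-- The three-dimensional homogeneous version of `exists_subset_square`: approximations of the
support function of a finite point set in a cube. -/
theorem exists_subset_cube {ι : Type*} (P K : Finset ι) (hK : K.Nonempty) (hKP : K ⊆ P)
    (c : ι → Fin 3 → ℝ) (hinj : Set.InjOn c K) (hc : ∀ p ∈ P, ∀ i, |c p i| ≤ 1) {ε : ℝ}
    (hε : 0 < ε) (A : ℕ) (hA : (8 / ε + 1) * (999 / 1000 : ℝ) ^ A ≤ 1 / 100)
    (happ : ∀ x : Fin 3 → ℝ, ∀ p ∈ P, ∃ k ∈ K, ∑ i, c p i * x i ≤ ∑ i, c k i * x i + ε * ‖x‖) :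
    ∃ P' ⊆ P, P'.card ≤ 12120 * (A + 1) * K.card ∧ ∀ x : Fin 3 → ℝ, ∀ p ∈ P, ∃ q ∈ P',
      ∑ i, c p i * x i ≤ ∑ i, c q i * x i + ε / 12 * ‖x‖ := by
  classical
  set sg : Bool → ℝ := fun b => if b then 1 else -1 with hsg
  have hsgabs : ∀ b, |sg b| = 1 := fun b => by cases b <;> simp [hsg]
  -- Parametrizes the face where coordinate `i` is `±1`, the remaining coordinates following
  -- cyclically. On the taller rectangle the norm is at most `2`, so the face problem has error `2 *
  -- ε`, and `2 * ε / 24 = ε / 12`.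
  set X : Fin 3 → Bool → ℝ → ℝ → Fin 3 → ℝ := fun i b x y j => ![sg b, x, y] (j - i) with hX
  have hsum : ∀ p i b x y, ∑ j, c p j * X i b x y j =
      sg b * c p (0 + i) + c p (1 + i) * x + c p (2 + i) * y := by
    intro p i b x y
    rw [← Equiv.sum_comp (Equiv.addRight i), Fin.sum_univ_three]
    simp [hX]
    ring
  have hnorm : ∀ i b, ∀ x ∈ Set.Icc (-1 : ℝ) 1, ∀ y ∈ Set.Icc (-2 : ℝ) 2, ‖X i b x y‖ ≤ 2 := by
    intro i b x hx y hy
    rw [pi_norm_le_iff_of_nonneg (by norm_num)]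
    have : ∀ j, ‖(![sg b, x, y] : Fin 3 → ℝ) j‖ ≤ 2 := by
      intro j
      fin_cases j
      · simp [hsgabs]
      · exact (abs_le.2 hx).trans (by norm_num)
      · exact abs_le.2 hy
    exact fun j => this (j - i)
  have hface : ∀ ib : Fin 3 × Bool, ∃ P' ⊆ P, P'.card ≤ 2020 * (A + 1) * K.card ∧
      ∀ x ∈ Set.Icc (-1 : ℝ) 1, ∀ y ∈ Set.Icc (-1 : ℝ) 1, ∀ p ∈ P, ∃ q ∈ P',
        ∑ j, c p j * X ib.1 ib.2 x y j ≤ ∑ j, c q j * X ib.1 ib.2 x y j + ε / 12 := by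
    rintro ⟨i, b⟩
    obtain ⟨P', h1, h2, h3⟩ := exists_subset_square P K hK hKP (fun p => sg b * c p (0 + i))
      (fun p => c p (1 + i)) (fun p => c p (2 + i)) (by
        intro k hk k' hk' heq
        simp only [Prod.mk.injEq] at heq
        obtain ⟨e0, e1, e2⟩ := heq
        have hs : sg b ≠ 0 := fun h => by simpa [h] using hsgabs b
        have e0 := mul_left_cancel₀ hs e0
        refine hinj hk hk' (funext fun j => ?_)
        have : ∀ j, c k (j + i) = c k' (j + i) := by
          intro j
          fin_cases j
          · exact e0
          · exact e1
          · exact e2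
        simpa using this (j - i))
      (fun p hp => by rw [abs_mul, hsgabs, one_mul]; exact hc p hp _)
      (fun p hp => hc p hp _) (fun p hp => hc p hp _) (ε := 2 * ε) (by linarith) A
      (by
        refine le_trans (mul_le_mul_of_nonneg_right ?_ (by positivity)) hA
        have : 8 / (2 * ε) ≤ 8 / ε := div_le_div_of_nonneg_left (by norm_num) hε (by linarith)
        linarith)
      (by
        intro x hx y hy p hp
        obtain ⟨k, hk, hle⟩ := happ (X i b x y) p hp
        rw [hsum, hsum] at hle
        have := mul_le_mul_of_nonneg_left (hnorm i b x hx y hy) hε.le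
        exact ⟨k, hk, by linarith⟩)
    refine ⟨P', h1, h2, fun x hx y hy p hp => ?_⟩
    obtain ⟨q, hq, hle⟩ := h3 x hx y hy p hp
    refine ⟨q, hq, ?_⟩
    rw [hsum, hsum]
    linarith
  choose g hgP hgc hg using hface
  refine ⟨Finset.univ.biUnion g, Finset.biUnion_subset.2 fun ib _ => hgP ib, ?_, ?_⟩
  · calc (Finset.univ.biUnion g).card ≤ ∑ ib, (g ib).card := Finset.card_biUnion_le
      _ ≤ ∑ ib : Fin 3 × Bool, 2020 * (A + 1) * K.card := Finset.sum_le_sum fun ib _ => hgc ib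
      _ = _ := by simp; ring
  · intro x p hp
    rcases eq_or_ne x 0 with rfl | hx0
    · obtain ⟨q, hq, -⟩ := hg (0, true) 0 (by simp) 0 (by simp) p hp
      exact ⟨q, Finset.mem_biUnion.2 ⟨_, Finset.mem_univ _, hq⟩, by simp⟩
    -- Scaling by a coordinate of largest absolute value moves `x` to a face.
    obtain ⟨i, -, hi⟩ := Finset.exists_max_image Finset.univ (fun i => |x i|) ⟨0, by simp⟩
    have hn : ‖x‖ = |x i| := le_antisymm
      ((pi_norm_le_iff_of_nonneg (abs_nonneg _)).2 fun j => hi j (by simp)) (norm_le_pi_norm x i)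
    have hpos : 0 < ‖x‖ := norm_pos_iff.2 hx0
    have hcoord : ∀ j, x j / ‖x‖ ∈ Set.Icc (-1 : ℝ) 1 := fun j => by
      rw [Set.mem_Icc, ← abs_le, abs_div, abs_of_pos hpos, div_le_one hpos]
      exact norm_le_pi_norm x j
    obtain ⟨b, hb⟩ : ∃ b, x i = ‖x‖ * sg b := by
      rcases abs_choice (x i) with h | h
      · exact ⟨true, by simp [hsg, hn, h]⟩
      · exact ⟨false, by simp [hsg, hn, h]⟩
    have hxX : ∀ j, x j = ‖x‖ * X i b (x (1 + i) / ‖x‖) (x (2 + i) / ‖x‖) j := by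
      have : ∀ j, x (j + i) = ‖x‖ * (![sg b, x (1 + i) / ‖x‖, x (2 + i) / ‖x‖] : Fin 3 → ℝ) j := by
        intro j
        fin_cases j
        · simpa using hb
        · exact (mul_div_cancel₀ _ hpos.ne').symm
        · exact (mul_div_cancel₀ _ hpos.ne').symm
      intro j
      simpa [hX] using this (j - i)
    have hs : ∀ p, ∑ j, c p j * x j =
        ‖x‖ * ∑ j, c p j * X i b (x (1 + i) / ‖x‖) (x (2 + i) / ‖x‖) j := fun p => by
      rw [Finset.mul_sum]
      refine Finset.sum_congr rfl fun j _ => ?_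
      conv_lhs => rw [hxX j]
      ring
    obtain ⟨q, hq, hle⟩ := hg (i, b) _ (hcoord (1 + i)) _ (hcoord (2 + i)) p hp
    refine ⟨q, Finset.mem_biUnion.2 ⟨_, Finset.mem_univ _, hq⟩, ?_⟩
    rw [hs p, hs q]
    nlinarith [mul_le_mul_of_nonneg_left hle hpos.le]

/-! ### Normalizing coordinates -/

/-- A finite spanning set contains a basis in which its elements have coordinates of absolute value
at most `1`. -/
theorem exists_basis_abs_repr_le_one {V : Type*} [AddCommGroup V] [Module ℝ V]
    [FiniteDimensional ℝ V] (D : Finset V) (hD : Submodule.span ℝ (D : Set V) = ⊤) :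
    ∃ b : Module.Basis (Fin (Module.finrank ℝ V)) ℝ V, (∀ i, b i ∈ D) ∧
      ∀ d ∈ D, ∀ i, |b.repr d i| ≤ 1 := by
  classical
  set r := Module.finrank ℝ V with hr
  obtain ⟨s, hsD, b₀, hb₀⟩ : ∃ s ⊆ (D : Set V), ∃ b₀ : Module.Basis s ℝ V, ⇑b₀ = Subtype.val := by
    obtain ⟨s, hs, hspan, hli⟩ := exists_linearIndependent ℝ (D : Set V)
    refine ⟨s, hs, Module.Basis.mk hli ?_, Module.Basis.coe_mk _ _⟩
    rw [Subtype.range_coe, hspan, hD]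
  have : Finite s := D.finite_toSet.subset hsD
  have := Fintype.ofFinite s
  have hcard : Fintype.card s = r := (Module.finrank_eq_card_basis b₀).symm
  set b₁ : Module.Basis (Fin r) ℝ V := b₀.reindex (Fintype.equivFinOfCardEq hcard) with hb₁
  have hb₁D : ∀ i, b₁ i ∈ D := fun i => by
    rw [hb₁, Module.Basis.reindex_apply, hb₀]
    exact hsD (Subtype.prop _)
  have : Nonempty (Fin r → D) := ⟨fun i => ⟨b₁ i, hb₁D i⟩⟩
  -- Choose a basis of maximal determinant. By Cramer's rule a coordinate of `d` is the factor by
  -- which replacing a basis vector by `d` changes the determinant.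
  obtain ⟨f, hf⟩ := Finite.exists_max fun f : Fin r → D => |b₁.det fun i => (f i : V)|
  have hpos : 0 < |b₁.det fun i => (f i : V)| := by
    have := hf fun i => ⟨b₁ i, hb₁D i⟩
    dsimp only at this
    rw [show (fun i => b₁ i) = ⇑b₁ from rfl, b₁.det_self, abs_one] at this
    linarith
  obtain ⟨hli, hsp⟩ := (b₁.is_basis_iff_det (v := fun i => (f i : V))).2
    (isUnit_iff_ne_zero.2 (abs_pos.1 hpos))
  refine ⟨Module.Basis.mk hli hsp.ge, fun i => by rw [Module.Basis.mk_apply]; exact (f i).2, ?_⟩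
  intro d hd i
  have h1 := congrArg (fun φ => φ d) (b₁.det_smul_mk_coord_eq_det_update hli hsp.ge i)
  simp only [LinearMap.smul_apply, Module.Basis.coord_apply, smul_eq_mul,
    MultilinearMap.toLinearMap_apply, AlternatingMap.coe_multilinearMap] at h1
  have h2 := hf (Function.update f i ⟨d, hd⟩)
  have h3 : (fun j => ((Function.update f i ⟨d, hd⟩ j : D) : V)) =
      Function.update (fun j => (f j : V)) i d := by
    funext j
    by_cases h : j = i
    · subst h; simp
    · simp [h]
  rw [h3, ← h1, abs_mul] at h2
  exact le_of_mul_le_mul_left (by linarith) hpos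

/-- Padding with zero coordinates lets lower-dimensional point sets be treated together with
full-dimensional ones. -/
theorem sum_dite_castLE {r n : ℕ} (hr : r ≤ n) (a : Fin r → ℝ) (x : Fin n → ℝ) :
    ∑ i : Fin n, (if h : (i : ℕ) < r then a ⟨i, h⟩ else 0) * x i =
      ∑ j : Fin r, a j * x (Fin.castLE hr j) := by
  symm
  refine Finset.sum_of_injOn (Fin.castLE hr) (Fin.castLE_injective hr).injOn (by simp) ?_ ?_
  · intro i _ hi
    have : ¬ (i : ℕ) < r := fun h => hi ⟨⟨i, h⟩, by simp, by ext; simp⟩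
    simp [this]
  · intro j _
    simp

/-- A finite point set has affine coordinates in a cube such that the coordinates of a direction are
inner products with differences of points. -/
theorem exists_coords {E : Type*} [NormedAddCommGroup E] [InnerProductSpace ℝ E]
    [FiniteDimensional ℝ E] {n : ℕ} (hE : Module.finrank ℝ E ≤ n) (P : Finset E) (p₀ : E) :
    ∃ c : E → Fin n → ℝ, Set.InjOn c P ∧ (∀ p ∈ P, ∀ i, |c p i| ≤ 1) ∧
      (∀ u : E, ∃ x : Fin n → ℝ, (∀ i, x i = 0 ∨ ∃ p ∈ P, x i = inner ℝ (p - p₀) u) ∧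
        ∀ p ∈ P, ∑ i, c p i * x i = inner ℝ (p - p₀) u) ∧
      ∀ x : Fin n → ℝ, ∃ u : E, ∀ p ∈ P, ∑ i, c p i * x i = inner ℝ (p - p₀) u := by
  classical
  set s : Set E := (fun p => p - p₀) '' P with hs
  set V := Submodule.span ℝ s with hV
  have hsV : ∀ p ∈ P, p - p₀ ∈ V := fun p hp => Submodule.subset_span ⟨p, hp, rfl⟩
  set v : E → V := fun p => if h : p - p₀ ∈ V then ⟨p - p₀, h⟩ else 0 with hv
  have hvP : ∀ p ∈ P, (v p : E) = p - p₀ := fun p hp => by simp [hv, hsV p hp]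
  have hspan : Submodule.span ℝ ((P.image v : Finset V) : Set V) = ⊤ := by
    rw [← Submodule.span_span_coe_preimage (s := s)]
    congr 1
    ext w
    simp only [Finset.coe_image, Set.mem_image, Finset.mem_coe, Set.mem_preimage, hs]
    constructor
    · rintro ⟨p, hp, rfl⟩
      exact ⟨p, hp, (hvP p hp).symm⟩
    · rintro ⟨p, hp, h⟩
      exact ⟨p, hp, Subtype.ext ((hvP p hp).trans h)⟩
  obtain ⟨b, hbD, hb⟩ := exists_basis_abs_repr_le_one (P.image v) hspan
  have hr : Module.finrank ℝ V ≤ n := V.finrank_le.trans hE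
  have hexp : ∀ p ∈ P, ∀ u : E, ∑ j, b.repr (v p) j * inner ℝ (b j : E) u = inner ℝ (p - p₀) u := by
    intro p hp u
    have h := congrArg (fun w : V => inner ℝ (w : E) u) (b.sum_repr (v p))
    simp only [Submodule.coe_sum, Submodule.coe_smul, sum_inner, real_inner_smul_left,
      hvP p hp] at h
    exact h
  refine ⟨fun p i => if h : (i : ℕ) < Module.finrank ℝ V then b.repr (v p) ⟨i, h⟩ else 0,
    ?_, ?_, ?_, ?_⟩
  · intro p hp q hq heq
    have : b.repr (v p) = b.repr (v q) := by
      ext j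
      simpa using congrFun heq (Fin.castLE hr j)
    have := congrArg Subtype.val (b.repr.injective this)
    rw [hvP p hp, hvP q hq] at this
    exact sub_left_injective this
  · intro p hp i
    dsimp only
    split_ifs with h
    · exact hb _ (Finset.mem_image_of_mem _ hp) _
    · simp
  · intro u
    refine ⟨fun i => if h : (i : ℕ) < Module.finrank ℝ V then inner ℝ (b ⟨i, h⟩ : E) u else 0,
      fun i => ?_, fun p hp => ?_⟩
    · dsimp only
      split_ifs with h
      · obtain ⟨p, hp, hpb⟩ := Finset.mem_image.1 (hbD ⟨i, h⟩)
        exact Or.inr ⟨p, hp, by rw [← hpb, hvP p hp]⟩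
      · exact Or.inl rfl
    · rw [sum_dite_castLE hr (fun j => b.repr (v p) j), ← hexp p hp u]
      simp
  · intro x
    -- A functional on the span with prescribed values on the basis extends to `E`; `u` is its Riesz
    -- representative.
    obtain ⟨φ, hφ⟩ := (b.constr ℝ fun j => x (Fin.castLE hr j)).exists_extend
    refine ⟨(InnerProductSpace.toDual ℝ E).symm φ.toContinuousLinearMap, fun p hp => ?_⟩
    rw [sum_dite_castLE hr (fun j => b.repr (v p) j), ← hexp p hp]
    refine Finset.sum_congr rfl fun j _ => ?_
    rw [real_inner_comm, InnerProductSpace.toDual_symm_apply]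
    congr 1
    have := congrArg (fun ψ => ψ (b j)) hφ
    simpa using this.symm

/-! ### Support functions, widths and kernels -/

theorem exists_supp_eq {d : ℕ} {P : Finset (EuclideanSpace ℝ (Fin d))} (hP : P.Nonempty)
    (u : EuclideanSpace ℝ (Fin d)) : ∃ p ∈ P, supp P u = inner ℝ p u := by
  have : Nonempty P := hP.to_subtype
  obtain ⟨p, hp⟩ := exists_eq_ciSup_of_finite
    (f := fun q : P => inner ℝ (q : EuclideanSpace ℝ (Fin d)) u)
  exact ⟨p, p.2, hp.symm⟩

theorem supp_smul {d : ℕ} (P : Finset (EuclideanSpace ℝ (Fin d))) {t : ℝ} (ht : 0 ≤ t)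
    (u : EuclideanSpace ℝ (Fin d)) : supp P (t • u) = t * supp P u := by
  unfold supp
  rw [Real.mul_iSup_of_nonneg ht]
  simp only [real_inner_smul_right]

theorem width_smul {d : ℕ} (P : Finset (EuclideanSpace ℝ (Fin d))) {t : ℝ} (ht : 0 ≤ t)
    (u : EuclideanSpace ℝ (Fin d)) : width P (t • u) = t * width P u := by
  unfold width
  rw [← smul_neg, supp_smul P ht, supp_smul P ht, mul_add]

theorem inner_sub_le_width {d : ℕ} {P : Finset (EuclideanSpace ℝ (Fin d))}
    {p q : EuclideanSpace ℝ (Fin d)} (hp : p ∈ P) (hq : q ∈ P) (u : EuclideanSpace ℝ (Fin d)) :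
    inner ℝ (p - q) u ≤ width P u := by
  have h1 := le_supp hp u
  have h2 := le_supp hq (-u)
  rw [inner_neg_right] at h2
  rw [inner_sub_left]
  unfold width
  linarith

/-- The kernel condition holds in all directions, not only for unit vectors. -/
theorem IsKernel.supp_sub_le {d : ℕ} {ε : ℝ} {P K : Finset (EuclideanSpace ℝ (Fin d))}
    (h : IsKernel ε P K) (u : EuclideanSpace ℝ (Fin d)) :
    supp P u - supp K u ≤ ε * width P u := by
  rcases eq_or_ne u 0 with rfl | hu
  · have h1 : ∀ Q : Finset (EuclideanSpace ℝ (Fin d)), supp Q 0 = 0 := fun Q => by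
      simpa using supp_smul Q le_rfl 0
    simp [width, h1]
  · have hpos := norm_pos_iff.2 hu
    have := mul_le_mul_of_nonneg_left (h.le_width (‖u‖⁻¹ • u) (by
      rw [norm_smul, norm_inv, norm_norm, inv_mul_cancel₀ hpos.ne'])) hpos.le
    rw [supp_smul P (by positivity), supp_smul K (by positivity), width_smul P (by positivity)] at this
    field_simp at this
    linarith

/-- An `ε`-kernel of size `k` in `ℝ³` yields an `ε / 2`-kernel of size `O(k log(1/ε))`. -/
theorem kappa_half_le {P : Finset (EuclideanSpace ℝ (Fin 3))} (hP : P.Nonempty) {ε : ℝ}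
    (hε : 0 < ε) (A : ℕ) (hA : (8 / ε + 1) * (999 / 1000 : ℝ) ^ A ≤ 1 / 100) :
    kappa P (ε / 2) ≤ 12120 * (A + 1) * kappa P ε := by
  obtain ⟨K, hK, hKc⟩ := exists_isKernel_card_eq_kappa hP hε
  obtain ⟨p₀, hp₀⟩ := hP
  obtain ⟨c, hinj, hc, hdir, hpt⟩ := exists_coords (n := 3) (by simp) P p₀
  -- The width is at most `6 * ‖x‖`, so `K` has absolute error `6 * ε`. The refined error `6 * ε /
  -- 12 = ε / 2` converts back without loss because `‖x‖ ≤ width P u`.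
  obtain ⟨P', hP', hcard, happ⟩ := exists_subset_cube P K hK.nonempty hK.subset c
    (hinj.mono (by exact_mod_cast hK.subset)) hc (ε := 6 * ε) (by linarith) A
    (by
      refine le_trans (mul_le_mul_of_nonneg_right ?_ (by positivity)) hA
      have : 8 / (6 * ε) ≤ 8 / ε := div_le_div_of_nonneg_left (by norm_num) hε (by linarith)
      linarith)
    (by
      intro x p hp
      obtain ⟨u, hu⟩ := hpt x
      obtain ⟨k, hk, hku⟩ := exists_supp_eq hK.nonempty u
      refine ⟨k, hk, ?_⟩
      have hle := hK.supp_sub_le u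
      obtain ⟨q₁, hq₁, e₁⟩ := exists_supp_eq ⟨p₀, hp₀⟩ u
      obtain ⟨q₂, hq₂, e₂⟩ := exists_supp_eq ⟨p₀, hp₀⟩ (-u)
      have hb : ∀ q ∈ P, |∑ i, c q i * x i| ≤ 3 * ‖x‖ := fun q hq => by
        calc |∑ i, c q i * x i| ≤ ∑ i, |c q i * x i| := Finset.abs_sum_le_sum_abs _ _
          _ ≤ ∑ i : Fin 3, ‖x‖ := Finset.sum_le_sum fun i _ => by
              rw [abs_mul]
              calc _ ≤ 1 * ‖x‖ := mul_le_mul (hc q hq i) (norm_le_pi_norm x i) (abs_nonneg _)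
                    zero_le_one
                _ = _ := one_mul _
          _ = _ := by simp
      have hw : width P u ≤ 6 * ‖x‖ := by
        have f₁ := abs_le.1 (hb q₁ hq₁)
        have f₂ := abs_le.1 (hb q₂ hq₂)
        rw [hu q₁ hq₁, inner_sub_left] at f₁
        rw [hu q₂ hq₂, inner_sub_left] at f₂
        unfold width
        rw [e₁, e₂, inner_neg_right]
        linarith [f₁.2, f₂.1]
      have hp' := le_supp hp u
      have := mul_le_mul_of_nonneg_left hw hε.le
      rw [hu p hp, hu k (hK.subset hk), inner_sub_left, inner_sub_left]
      linarith)
  have hne : P'.Nonempty := by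
    obtain ⟨q, hq, -⟩ := happ 0 p₀ hp₀
    exact ⟨q, hq⟩
  have hker : IsKernel (ε / 2) P P' := by
    refine ⟨hP', hne, fun u _ => ?_⟩
    obtain ⟨x, hx, hxu⟩ := hdir u
    obtain ⟨p, hp, e⟩ := exists_supp_eq ⟨p₀, hp₀⟩ u
    obtain ⟨q, hq, hle⟩ := happ x p hp
    -- Each coordinate of `x` is `0` or an inner product of `u` with a difference of points of `P`.
    have hxw : ‖x‖ ≤ width P u := by
      rw [pi_norm_le_iff_of_nonneg (width_nonneg ⟨p₀, hp₀⟩ u)]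
      intro i
      rcases hx i with h | ⟨q, hq, h⟩
      · rw [h, norm_zero]; exact width_nonneg ⟨p₀, hp₀⟩ u
      · rw [h, Real.norm_eq_abs, abs_le]
        have h1 := inner_sub_le_width hq hp₀ u
        have h2 := inner_sub_le_width hp₀ hq u
        rw [← neg_sub, inner_neg_left] at h2
        exact ⟨by linarith, h1⟩
    have hqs := le_supp hq u
    have := mul_le_mul_of_nonneg_left hxw hε.le
    rw [hxu p hp, hxu q (hP' hq), inner_sub_left, inner_sub_left] at hle
    rw [e]
    linarith
  rw [← hKc]
  refine le_trans (Nat.sInf_le ?_) hcard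
  exact ⟨P', hker, rfl⟩

end EpsKernel

theorem mainTheorem4 :
    ∃ C : ℝ, 0 < C ∧
      ∀ (P : Finset (EuclideanSpace ℝ (Fin 3))), P.Nonempty → ∀ ε : ℝ, 0 < ε →
        (EpsKernel.kappa P (ε / 2) : ℝ) / (EpsKernel.kappa P ε : ℝ)
          ≤ C * max 1 (Real.log (1 / ε)) := by
  obtain ⟨C, hC, h⟩ := EpsKernel.exists_pow_le_log
  refine ⟨12120 * C, by positivity, fun P hP ε hε => ?_⟩
  obtain ⟨A, hA, hAC⟩ := h ε hε
  have hpos : (0 : ℝ) < EpsKernel.kappa P ε := by exact_mod_cast EpsKernel.kappa_pos hP hε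
  have hle : (EpsKernel.kappa P (ε / 2) : ℝ) ≤ 12120 * ((A + 1 : ℕ) : ℝ) * EpsKernel.kappa P ε := by
    exact_mod_cast EpsKernel.kappa_half_le hP hε A hA
  rw [div_le_iff₀ hpos]
  refine hle.trans (mul_le_mul_of_nonneg_right ?_ hpos.le)
  rw [mul_assoc]
  exact mul_le_mul_of_nonneg_left hAC (by norm_num)
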